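/- Let $\lambda<1$ and consider the diagonal kernel $\overline K(x,y)=x^{\lambda+1}\delta(x-y)$ on $(0,\infty)$. The non-gelling scaling equation with this kernel is $$a^2\Phi(a)=\int_0^a dx\,x\Phi(x)\int_{a-x}^\infty dy\,\overline K(x,y)\Phi(y)\qquad(a>0),$$ that is, $x^2\Phi(x)=\int_{x/2}^x y^{\lambda+2}\Phi(y)^2\,dy$ for all $x>0$ (with convergent integrals); a solution is a real-valued function $\Phi$ on $(0,\infty)$ satisfying it. The equation $$\frac{1+\Delta}{2}=\frac{1-2^{(\lambda-1)(\Delta+1)}}{1-2^{\lambda-1}}$$ has exactly one positive root $\Delta$. Put $\delta=(1-\lambda)\Delta$. There is an $\epsilon>0$ such that for every $c>0$ the scaling equation has a solution $\Phi=\Phi_c$ with $$\Phi(x)=x^{-(1+\lambda)}\left[\frac{1-\lambda}{1-2^{\lambda-1}}-c\,x^{\delta}+O\!\left(x^{\delta+\epsilon}\right)\right]\qquad(x\to0^+).$$ This solution is uniquely determined by $c$: every solution that has such an expansion with the same $c$ and with some $\epsilon'>0$ in place of $\epsilon$ coincides with $\Phi_c$ on $(0,\infty)$. Furthermore the function $\psi(x)=x^{1+\lambda}\Phi_c(x)$,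 extended to $x=0$ by its limit $\psi(0)=(1-\lambda)/(1-2^{\lambda-1})$, is positive and strictly decreasing on $[0,\infty)$, it satisfies $\psi(x)\le C e^{-ax}$ for all $x\geq0$ with some constants $C,a>0$, and it is $C^\infty$ on $[0,\infty)$ as a function of the variable $x^{\delta}$ (with one-sided derivatives at $0$). Finally, $c>0$ can be chosen such that $\int_0^\infty x\Phi_c(x)\,dx=1$. -/

import Mathlib

open MeasureTheory Set Filter Topology Asymptotics
open scoped ContDiff

noncomputable section

namespace DiagonalAggregation

/-- The diagonal kernel `K(x, y) = x ^ (lam + 1) * δ (x - y)`, read as the measure `K(x, dy)` in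
the second variable: the Dirac mass at `x` with weight `x ^ (lam + 1)`. -/
def diagonalKernel (lam x : ℝ) : Measure ℝ :=
  ENNReal.ofReal (x ^ (lam + 1)) • Measure.dirac x

/-- `Φ` solves the non-gelling scaling equation with kernel `K(x, dy)`: for all `a > 0`,
`a ^ 2 * Φ a = ∫_0^a x * Φ x * (∫_{a - x}^∞ Φ y K(x, dy)) dx`, where the integrals converge.
Only the values of `Φ` on `(0, ∞)` matter. -/
def IsScalingSolution (K : ℝ → Measure ℝ) (Φ : ℝ → ℝ) : Prop :=
  ∀ a : ℝ, 0 < a →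
    (∀ᵐ x ∂(volume.restrict (Ioc 0 a)), IntegrableOn Φ (Ioi (a - x)) (K x)) ∧
    IntegrableOn (fun x => x * Φ x * ∫ y in Ioi (a - x), Φ y ∂(K x)) (Ioc 0 a) ∧
    a ^ 2 * Φ a = ∫ x in Ioc 0 a, x * Φ x * ∫ y in Ioi (a - x), Φ y ∂(K x)

/-- The transcendental equation for the exponent `Δ`. -/
def ExponentEquation (lam Δ : ℝ) : Prop :=
  (1 + Δ) / 2 = (1 - (2 : ℝ) ^ ((lam - 1) * (Δ + 1))) / (1 - (2 : ℝ) ^ (lam - 1))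

/-- The value at the origin of `x ^ (1 + lam) * Φ x`. -/
def psiZero (lam : ℝ) : ℝ := (1 - lam) / (1 - (2 : ℝ) ^ (lam - 1))

/-- `Φ x = x ^ (-(1 + lam)) * (psiZero lam - c * x ^ δ + O (x ^ (δ + ε)))` as `x → 0+`;
both sides are multiplied by `x ^ (1 + lam)`. -/
def HasExpansion (lam δ c ε : ℝ) (Φ : ℝ → ℝ) : Prop :=
  (fun x : ℝ => x ^ (1 + lam) * Φ x - (psiZero lam - c * x ^ δ)) =O[𝓝[>] 0]
    (fun x : ℝ => x ^ (δ + ε))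

/-- The function `x ^ (1 + lam) * Φ x` on `[0, ∞)`, with its limit `psiZero lam` as the value
at `0`. -/
def profile (lam : ℝ) (Φ : ℝ → ℝ) (x : ℝ) : ℝ :=
  if x = 0 then psiZero lam else x ^ (1 + lam) * Φ x

/-- For the diagonal kernel the scaling equation is
`a ^ 2 * Φ a = ∫_{a / 2}^a x ^ (lam + 2) * Φ x ^ 2 dx`. -/
theorem isScalingSolution_diagonalKernel_iff (lam : ℝ) (Φ : ℝ → ℝ) :
    IsScalingSolution (diagonalKernel lam) Φ ↔
      ∀ a : ℝ, 0 < a →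
        IntegrableOn (fun x => x ^ (lam + 2) * Φ x ^ 2) (Ioc (a / 2) a) ∧
        a ^ 2 * Φ a = ∫ x in Ioc (a / 2) a, x ^ (lam + 2) * Φ x ^ 2 := by
  have key : ∀ a : ℝ, 0 < a → ∀ x ∈ Ioc 0 a,
      x * Φ x * ∫ y in Ioi (a - x), Φ y ∂(diagonalKernel lam x) =
        (Ioc (a / 2) a).indicator (fun x => x ^ (lam + 2) * Φ x ^ 2) x := by
    intro a _ x hx
    have h0 : 0 < x := hx.1
    have h1 : x ^ (lam + 2) = x ^ (lam + 1) * x := by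
      rw [show lam + 2 = lam + 1 + 1 by ring, Real.rpow_add_one h0.ne']
    have h2 : 0 ≤ x ^ (lam + 1) := Real.rpow_nonneg h0.le _
    classical
    rw [diagonalKernel, Measure.restrict_smul, integral_smul_measure,
      restrict_dirac, ENNReal.toReal_ofReal h2]
    by_cases h : x ∈ Ioi (a - x)
    · have h3 : x ∈ Ioc (a / 2) a := ⟨by have := mem_Ioi.1 h; linarith, hx.2⟩
      rw [if_pos h, integral_dirac, indicator_of_mem h3, h1, smul_eq_mul]
      ring
    · have h3 : x ∉ Ioc (a / 2) a := fun h4 => h (mem_Ioi.2 (by linarith [h4.1]))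
      rw [if_neg h, indicator_of_notMem h3]
      simp
  have hinner : ∀ a x : ℝ, IntegrableOn Φ (Ioi (a - x)) (diagonalKernel lam x) := fun a x =>
    ((integrable_dirac (by simp)).smul_measure ENNReal.ofReal_ne_top).integrableOn
  refine forall₂_congr fun a ha => ?_
  have hsub : Ioc (a / 2) a ⊆ Ioc 0 a := Ioc_subset_Ioc_left (by linarith)
  rw [integrableOn_congr_fun (key a ha) measurableSet_Ioc,
    setIntegral_congr_fun measurableSet_Ioc (key a ha),
    setIntegral_indicator measurableSet_Ioc, inter_eq_right.2 hsub,
    integrableOn_indicator_iff measurableSet_Ioc, inter_eq_left.2 hsub]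
  exact ⟨fun h => h.2, fun h => ⟨ae_of_all _ (hinner a), h⟩⟩

end DiagonalAggregation

end

/-! Put `h x = x ^ (1 + lam) * Φ x / psiZero lam`. Substituting `y = a * z` turns the scaling
equation into `h a = E[h (a Z) ^ 2]`, where `Z` lives on `(1/2, 1]` with density `psiZero lam * z ^
(-lam)`; the constant `psiZero lam` is exactly what makes this a probability law. In the variable `s
= κ * x ^ δ`, with `κ = c / psiZero lam` and `h x = F s`, it reads `F s = E[F (s ρ) ^ 2]` with `ρ =
Z ^ δ`, and the expansion becomes `F s = 1 - s + o(s)`. The linear term forces `2 E[ρ] = 1`, which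
is the exponent equation. Everything rests on two consequences: `2 E[ρ ^ a] < 1` for `a > 1`, and
`E[ρ ^ n] → 0`.

Existence (`IsSplitting.exists_solution`): iterating from `exp (-s)` gives an increasing sequence,
bounded by `exp (-s) + K * s ^ 2`; the limit inherits monotonicity and convexity. Uniqueness
(`IsSplitting.eqOn_Ioi`): near the origin the sum of two solutions is close to `2`, so a difference
of order `s ^ a` contracts by a factor close to `2 E[ρ ^ a]`; agreement near the origin then
propagates, because the difference is `O(s ^ n)` for every `n`. Smoothness: away from the origin by
bootstrapping the integral equation; at the origin because a convergent power series also solves the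
equation locally and uniqueness identifies the two (`IsSplitting.contDiffWithinAt_zero`). Decay and
strict monotonicity come from `F (2 ^ δ * s) ≤ F s ^ 2`, valid since `Z > 1/2`. Changing `c` dilates
`x`, so the mass can be normalised. -/

namespace SmoothingEquation

/-! ### Moments of the factor and existence by monotone iteration. -/

variable {Ω : Type*} [MeasurableSpace Ω]

/-- A random factor in `(0, 1)` with mean `1 / 2`. -/
structure IsSplitting (ν : Measure Ω) (ρ : Ω → ℝ) : Prop where
  measurable : Measurable ρ
  mem : ∀ᵐ w ∂ν, ρ w ∈ Ioo (0 : ℝ) 1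
  mean : ∫ w, ρ w ∂ν = 1 / 2

variable {ν : Measure Ω} {ρ : Ω → ℝ}

theorem IsSplitting.moment_nonneg (h : IsSplitting ν ρ) (a : ℝ) : 0 ≤ ∫ w, ρ w ^ a ∂ν :=
  integral_nonneg_of_ae (h.mem.mono fun _ hw => Real.rpow_nonneg hw.1.le _)

/-- The iterates of `F ↦ ∫ F (s ρ) ^ 2`, starting from `exp (-|s|)`. -/
noncomputable def iter (ν : Measure Ω) (ρ : Ω → ℝ) : ℕ → ℝ → ℝ
  | 0 => fun s => Real.exp (-|s|)
  | n + 1 => fun s => ∫ w, iter ν ρ n (s * ρ w) ^ 2 ∂ν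

theorem iter_zero_sq {s r : ℝ} (hs : 0 ≤ s) (hr : 0 < r) :
    iter ν ρ 0 (s * r) ^ 2 = Real.exp (-(2 * (s * r))) := by
  simp only [iter]
  rw [abs_of_nonneg (by positivity), ← Real.exp_nat_mul]
  congr 1
  push_cast
  ring

variable [IsProbabilityMeasure ν]

theorem IsSplitting.integrable_rpow (h : IsSplitting ν ρ) {a : ℝ} (ha : 0 ≤ a) :
    Integrable (fun w => ρ w ^ a) ν := by
  refine Integrable.of_bound (h.measurable.pow_const a).aestronglyMeasurable 1 ?_
  filter_upwards [h.mem] with w hw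
  rw [Real.norm_of_nonneg (Real.rpow_nonneg hw.1.le _)]
  exact Real.rpow_le_one hw.1.le hw.2.le ha

theorem IsSplitting.integrable_pow (h : IsSplitting ν ρ) (n : ℕ) :
    Integrable (fun w => ρ w ^ n) ν := by
  simpa using h.integrable_rpow (Nat.cast_nonneg n)

theorem IsSplitting.integrable (h : IsSplitting ν ρ) : Integrable ρ ν := by
  simpa using h.integrable_pow 1

/-- Since `ρ ^ a < ρ` almost surely, the mean drops strictly below `1 / 2`. This strict inequality
drives every contraction below. -/
theorem IsSplitting.moment_lt_half (h : IsSplitting ν ρ) {a : ℝ} (ha : 1 < a) :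
    ∫ w, ρ w ^ a ∂ν < 1 / 2 := by
  have hi := h.integrable_rpow (zero_le_one.trans ha.le)
  have hlt : ∀ᵐ w ∂ν, 0 < ρ w - ρ w ^ a := by
    filter_upwards [h.mem] with w hw
    simpa using Real.rpow_lt_rpow_of_exponent_gt hw.1 hw.2 ha
  have hpos : 0 < ∫ w, (ρ w - ρ w ^ a) ∂ν := by
    rw [integral_pos_iff_support_of_nonneg_ae (hlt.mono fun _ => le_of_lt) (h.integrable.sub hi)]
    have : Function.support (fun w => ρ w - ρ w ^ a) =ᵐ[ν] univ :=
      eventuallyEq_univ.2 (hlt.mono fun _ hw => hw.ne')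
    rw [measure_congr this]
    simp
  rw [integral_sub h.integrable hi, h.mean] at hpos
  linarith

theorem IsSplitting.sq_moment_lt_half (h : IsSplitting ν ρ) : ∫ w, ρ w ^ 2 ∂ν < 1 / 2 := by
  simpa using h.moment_lt_half one_lt_two

theorem IsSplitting.tendsto_moment (h : IsSplitting ν ρ) :
    Tendsto (fun n : ℕ => ∫ w, ρ w ^ (n : ℝ) ∂ν) atTop (𝓝 0) := by
  have := tendsto_integral_of_dominated_convergence (μ := ν)
    (F := fun (n : ℕ) w => ρ w ^ (n : ℝ)) (f := fun _ => 0) (fun _ => 1)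
    (fun n => (h.measurable.pow_const _).aestronglyMeasurable) (integrable_const _)
    (fun n => h.mem.mono fun w hw => by
      rw [Real.norm_of_nonneg (Real.rpow_nonneg hw.1.le _)]
      exact Real.rpow_le_one hw.1.le hw.2.le n.cast_nonneg)
    (h.mem.mono fun w hw => by
      simpa using tendsto_pow_atTop_nhds_zero_of_lt_one hw.1.le hw.2)
  simpa using this

theorem iter_mem (n : ℕ) (s : ℝ) : iter ν ρ n s ∈ Icc (0 : ℝ) 1 := by
  induction n generalizing s with
  | zero => exact ⟨(Real.exp_pos _).le, Real.exp_le_one_iff.2 (by simp)⟩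
  | succ n ih =>
    have hb : ∀ t, iter ν ρ n t ^ 2 ≤ 1 := fun t => pow_le_one₀ (ih t).1 (ih t).2
    refine ⟨integral_nonneg fun _ => sq_nonneg _, ?_⟩
    have := norm_integral_le_of_norm_le_const (μ := ν) (C := 1)
      (f := fun w => iter ν ρ n (s * ρ w) ^ 2)
      (ae_of_all _ fun w => by rw [Real.norm_of_nonneg (sq_nonneg _)]; exact hb _)
    simp only [probReal_univ, mul_one] at this
    exact (le_abs_self _).trans this

theorem IsSplitting.continuous_iter (h : IsSplitting ν ρ) (n : ℕ) : Continuous (iter ν ρ n) := by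
  induction n with
  | zero => exact Real.continuous_exp.comp continuous_abs.neg
  | succ n ih =>
    refine continuous_of_dominated (bound := fun _ => 1)
      (fun s => ?_) (fun s => ae_of_all _ fun w => ?_) (integrable_const _)
      (ae_of_all _ fun w => by fun_prop)
    · exact ((ih.measurable.comp (h.measurable.const_mul s)).pow_const 2).aestronglyMeasurable
    · rw [Real.norm_of_nonneg (sq_nonneg _)]
      exact pow_le_one₀ (iter_mem n _).1 (iter_mem n _).2

/-- Integrability of the square of a bounded measurable function along the factor. -/
theorem IsSplitting.integrable_sq (h : IsSplitting ν ρ) {F : ℝ → ℝ} (hF : Measurable F)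
    (hb : ∀ s, F s ∈ Icc (0 : ℝ) 1) (s : ℝ) : Integrable (fun w => F (s * ρ w) ^ 2) ν :=
  Integrable.of_bound ((hF.comp (h.measurable.const_mul s)).pow_const 2).aestronglyMeasurable 1
    (ae_of_all _ fun w => by
      rw [Real.norm_of_nonneg (sq_nonneg _)]
      exact pow_le_one₀ (hb _).1 (hb _).2)

theorem IsSplitting.integrable_iter (h : IsSplitting ν ρ) (n : ℕ) (s : ℝ) :
    Integrable (fun w => iter ν ρ n (s * ρ w) ^ 2) ν :=
  h.integrable_sq (h.continuous_iter n).measurable (iter_mem n) s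

/-- Jensen's inequality for `exp (-2 s ρ)`, whose exponent has mean `-s`, carried out through the
tangent line of `exp` at `-s`. -/
theorem IsSplitting.iter_zero_le_one (h : IsSplitting ν ρ) {s : ℝ} (hs : 0 ≤ s) :
    iter ν ρ 0 s ≤ iter ν ρ 1 s := by
  have hj : Integrable (fun w => s - 2 * s * ρ w) ν :=
    (integrable_const s).sub (h.integrable.const_mul (2 * s))
  have hi : Integrable (fun w => Real.exp (-s) * (1 + (s - 2 * s * ρ w))) ν :=
    ((integrable_const (1 : ℝ)).add hj).const_mul _
  calc iter ν ρ 0 s = ∫ w, Real.exp (-s) * (1 + (s - 2 * s * ρ w)) ∂ν := by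
        rw [integral_const_mul, integral_add (integrable_const _) hj,
          integral_sub (integrable_const _) (h.integrable.const_mul (2 * s)),
          integral_const_mul, h.mean]
        simp [iter, abs_of_nonneg hs]
        ring
    _ ≤ iter ν ρ 1 s := by
        refine integral_mono_ae hi (h.integrable_iter 0 s) ?_
        filter_upwards [h.mem] with w hw
        rw [iter_zero_sq hs hw.1, show -(2 * (s * ρ w)) = -s + (s - 2 * s * ρ w) by ring,
          Real.exp_add]
        gcongr
        linarith [Real.add_one_le_exp (s - 2 * s * ρ w)]

theorem exp_neg_le {u : ℝ} (hu : 0 ≤ u) : Real.exp (-u) ≤ 1 - u + u ^ 2 / 2 := by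
  have h1 := Real.quadratic_le_exp_of_nonneg hu
  have h2 : 0 < 1 + u + u ^ 2 / 2 := by positivity
  have h3 : (1 - u + u ^ 2 / 2) * (1 + u + u ^ 2 / 2) = 1 + u ^ 4 / 4 := by ring
  rw [Real.exp_neg]
  refine (inv_anti₀ h2 h1).trans ?_
  rw [inv_eq_one_div, div_le_iff₀ h2, h3]
  have : 0 ≤ u ^ 4 / 4 := by positivity
  linarith

theorem IsSplitting.iter_one_le (h : IsSplitting ν ρ) {s : ℝ} (hs : 0 ≤ s) :
    iter ν ρ 1 s ≤ iter ν ρ 0 s + 2 * (∫ w, ρ w ^ 2 ∂ν) * s ^ 2 := by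
  have h1 : Integrable (fun w => 1 - 2 * s * ρ w) ν :=
    (integrable_const (1 : ℝ)).sub (h.integrable.const_mul (2 * s))
  have h2 : Integrable (fun w => 2 * s ^ 2 * ρ w ^ 2) ν := (h.integrable_pow 2).const_mul _
  calc iter ν ρ 1 s ≤ ∫ w, (1 - 2 * s * ρ w + 2 * s ^ 2 * ρ w ^ 2) ∂ν := by
        refine integral_mono_ae (h.integrable_iter 0 s) (h1.add h2) ?_
        filter_upwards [h.mem] with w hw
        rw [iter_zero_sq hs hw.1]
        refine (exp_neg_le (mul_nonneg zero_le_two (mul_nonneg hs hw.1.le))).trans_eq ?_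
        ring
    _ = 1 - s + 2 * (∫ w, ρ w ^ 2 ∂ν) * s ^ 2 := by
        rw [integral_add h1 h2, integral_sub (integrable_const _) (h.integrable.const_mul _),
          integral_const_mul, integral_const_mul, h.mean]
        simp
        ring
    _ ≤ _ := by
        have := Real.add_one_le_exp (-s)
        simp only [iter, abs_of_nonneg hs]
        linarith

theorem IsSplitting.iter_mono (h : IsSplitting ν ρ) (n : ℕ) {s : ℝ} (hs : 0 ≤ s) :
    iter ν ρ n s ≤ iter ν ρ (n + 1) s := by
  induction n generalizing s with
  | zero => exact h.iter_zero_le_one hs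
  | succ n ih =>
    refine integral_mono_ae (h.integrable_iter n s) (h.integrable_iter (n + 1) s) ?_
    filter_upwards [h.mem] with w hw
    exact pow_le_pow_left₀ (iter_mem n _).1 (ih (mul_nonneg hs hw.1.le)) 2

/-- The iterates lie in `[0, 1]`, so squaring at most doubles the excess over `exp (-s)`. An excess
`K * s ^ 2` thus becomes at most `2 * m * K * s ^ 2`, plus the first-step error `2 * m * s ^ 2`. The
constant is the fixed point of `K = 2 * m * K + 2 * m`, which is nonnegative because `2 * m < 1`. -/
theorem IsSplitting.iter_le (h : IsSplitting ν ρ) (n : ℕ) {s : ℝ} (hs : 0 ≤ s) :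
    iter ν ρ n s ≤ Real.exp (-s) +
      2 * (∫ w, ρ w ^ 2 ∂ν) / (1 - 2 * ∫ w, ρ w ^ 2 ∂ν) * s ^ 2 := by
  set m := ∫ w, ρ w ^ 2 ∂ν with hm
  have hm1 : 0 < 1 - 2 * m := by linarith [h.sq_moment_lt_half]
  have hm0 : 0 ≤ m := integral_nonneg fun _ => sq_nonneg _
  set K := 2 * m / (1 - 2 * m) with hK
  have hK0 : 0 ≤ K := by positivity
  have hKm : 2 * m * K + 2 * m = K := by
    rw [hK]; field_simp; ring
  have he : ∀ t, 0 ≤ t → iter ν ρ 0 t = Real.exp (-t) := fun t ht => by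
    simp [iter, abs_of_nonneg ht]
  induction n generalizing s with
  | zero => rw [he s hs]; exact le_add_of_nonneg_right (by positivity)
  | succ n ih =>
    have hi : Integrable (fun w => 2 * (K * s ^ 2) * ρ w ^ 2) ν := (h.integrable_pow 2).const_mul _
    have h1 : iter ν ρ (n + 1) s ≤
        ∫ w, (iter ν ρ 0 (s * ρ w) ^ 2 + 2 * (K * s ^ 2) * ρ w ^ 2) ∂ν := by
      refine integral_mono_ae (h.integrable_iter n s) ((h.integrable_iter 0 s).add hi) ?_
      filter_upwards [h.mem] with w hw
      have ht : 0 ≤ s * ρ w := mul_nonneg hs hw.1.le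
      have h2 := ih ht
      rw [← he _ ht] at h2
      have h3 := iter_mem (ν := ν) (ρ := ρ) n (s * ρ w)
      have h4 := iter_mem (ν := ν) (ρ := ρ) 0 (s * ρ w)
      have h5 : 0 ≤ K * (s * ρ w) ^ 2 := by positivity
      nlinarith [h3.1, h3.2, h4.1, h4.2]
    rw [integral_add (h.integrable_iter 0 s) hi, integral_const_mul, ← hm] at h1
    have h6 := h.iter_one_le hs
    rw [he s hs, ← hm] at h6
    have h7 : iter ν ρ 1 s = ∫ w, iter ν ρ 0 (s * ρ w) ^ 2 ∂ν := rfl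
    nlinarith [sq_nonneg s]

theorem IsSplitting.antitoneOn_iter (h : IsSplitting ν ρ) (n : ℕ) :
    AntitoneOn (iter ν ρ n) (Ici 0) := by
  induction n with
  | zero =>
    intro s hs t ht hst
    simpa [iter, abs_of_nonneg (mem_Ici.1 hs), abs_of_nonneg (mem_Ici.1 ht)] using hst
  | succ n ih =>
    intro s hs t ht hst
    refine integral_mono_ae (h.integrable_iter n t) (h.integrable_iter n s) ?_
    filter_upwards [h.mem] with w hw
    exact pow_le_pow_left₀ (iter_mem n _).1 (ih (mul_nonneg hs hw.1.le)
      (mul_nonneg ht hw.1.le) (mul_le_mul_of_nonneg_right hst hw.1.le)) 2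

/-- The square of a nonnegative convex function is convex, and averaging preserves convexity. It
serves to make the limit strictly decreasing. -/
theorem IsSplitting.convexOn_iter (h : IsSplitting ν ρ) (n : ℕ) :
    ConvexOn ℝ (Ici 0) (iter ν ρ n) := by
  induction n with
  | zero =>
    refine ⟨convex_Ici 0, fun s hs t ht a b ha hb hab => ?_⟩
    have := convexOn_exp.2 (mem_univ (-s)) (mem_univ (-t)) ha hb hab
    have hst : 0 ≤ a * s + b * t := add_nonneg (mul_nonneg ha hs) (mul_nonneg hb ht)
    simp only [iter, smul_eq_mul, abs_of_nonneg (mem_Ici.1 hs), abs_of_nonneg (mem_Ici.1 ht),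
      abs_of_nonneg hst] at this ⊢
    convert this using 2
    ring
  | succ n ih =>
    refine ⟨convex_Ici 0, fun s hs t ht a b ha hb hab => ?_⟩
    have hsq := ih.pow (fun _ _ => (iter_mem n _).1) 2
    simp only [iter, smul_eq_mul]
    rw [← integral_const_mul, ← integral_const_mul, ← integral_add
      ((h.integrable_iter n s).const_mul a) ((h.integrable_iter n t).const_mul b)]
    refine integral_mono_ae (h.integrable_iter n _) (((h.integrable_iter n s).const_mul a).add
      ((h.integrable_iter n t).const_mul b)) ?_
    filter_upwards [h.mem] with w hw
    have := hsq.2 (mul_nonneg hs hw.1.le : s * ρ w ∈ Ici 0) (mul_nonneg ht hw.1.le) ha hb hab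
    simp only [smul_eq_mul, Pi.pow_apply] at this
    convert this using 3
    ring

theorem IsSplitting.exists_solution (h : IsSplitting ν ρ) :
    ∃ F : ℝ → ℝ, Measurable F ∧ (∀ s, F s ∈ Icc (0 : ℝ) 1) ∧
      (∀ s, 0 ≤ s → F s = ∫ w, F (s * ρ w) ^ 2 ∂ν) ∧
      (∀ s, 0 ≤ s → Real.exp (-s) ≤ F s) ∧
      (∃ K : ℝ, ∀ s, 0 ≤ s → |F s - (1 - s)| ≤ K * s ^ 2) ∧
      AntitoneOn F (Ici 0) ∧ ConvexOn ℝ (Ici 0) F := by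
  -- Evaluating at `|s|` defines the limit on the whole line, so that it is measurable there.
  have hlim : ∀ s, ∃ l, Tendsto (fun n => iter ν ρ n |s|) atTop (𝓝 l) := fun s =>
    ⟨_, tendsto_atTop_ciSup (monotone_nat_of_le_succ fun n => h.iter_mono n (abs_nonneg s))
      ⟨1, by rintro _ ⟨n, rfl⟩; exact (iter_mem n _).2⟩⟩
  choose F hF using hlim
  have hF' : ∀ s, 0 ≤ s → Tendsto (fun n => iter ν ρ n s) atTop (𝓝 (F s)) := fun s hs => by
    simpa [abs_of_nonneg hs] using hF s
  have hlow : ∀ s, 0 ≤ s → Real.exp (-s) ≤ F s := fun s hs => by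
    refine ge_of_tendsto' (hF' s hs) fun n => ?_
    have := (monotone_nat_of_le_succ fun n => h.iter_mono n hs) (Nat.zero_le n)
    simpa [iter, abs_of_nonneg hs] using this
  refine ⟨F, measurable_of_tendsto_metrizable
      (fun n => (h.continuous_iter n).measurable.comp measurable_norm)
      (tendsto_pi_nhds.2 fun s => by simpa using hF s),
    fun s => isClosed_Icc.mem_of_tendsto (hF s) (Eventually.of_forall fun n => iter_mem n _),
    fun s hs => ?_, hlow, ?_, ?_, ?_⟩
  · refine tendsto_nhds_unique ((hF' s hs).comp (tendsto_add_atTop_nat 1)) ?_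
    refine tendsto_integral_of_dominated_convergence (fun _ => 1)
      (fun n => (h.integrable_iter n s).aestronglyMeasurable) (integrable_const _)
      (fun n => ae_of_all _ fun w => ?_) ?_
    · rw [Real.norm_of_nonneg (sq_nonneg _)]
      exact pow_le_one₀ (iter_mem n _).1 (iter_mem n _).2
    · filter_upwards [h.mem] with w hw
      exact (hF' _ (mul_nonneg hs hw.1.le)).pow 2
  · refine ⟨2 * (∫ w, ρ w ^ 2 ∂ν) / (1 - 2 * ∫ w, ρ w ^ 2 ∂ν) + 1 / 2, fun s hs => ?_⟩
    have h1 := le_of_tendsto' (hF' s hs) fun n => h.iter_le n hs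
    have h2 := hlow s hs
    have h3 := Real.add_one_le_exp (-s)
    have h4 := exp_neg_le hs
    have hm : 0 ≤ 2 * (∫ w, ρ w ^ 2 ∂ν) / (1 - 2 * ∫ w, ρ w ^ 2 ∂ν) * s ^ 2 := by
      have hm1 : 0 < 1 - 2 * ∫ w, ρ w ^ 2 ∂ν := by linarith [h.sq_moment_lt_half]
      have hm0 : 0 ≤ ∫ w, ρ w ^ 2 ∂ν := integral_nonneg fun _ => sq_nonneg _
      positivity
    rw [abs_le]
    constructor <;> nlinarith [sq_nonneg s]
  · intro s hs t ht hst
    exact le_of_tendsto_of_tendsto' (hF' t ht) (hF' s hs) fun n => h.antitoneOn_iter n hs ht hst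
  · refine ⟨convex_Ici 0, fun s hs t ht a b ha hb hab => ?_⟩
    exact le_of_tendsto_of_tendsto'
      (hF' _ (add_nonneg (mul_nonneg ha hs) (mul_nonneg hb ht)))
      (((hF' s hs).const_smul a).add ((hF' t ht).const_smul b))
      fun n => (h.convexOn_iter n).2 hs ht ha hb hab

end SmoothingEquation

/-! ### Uniqueness by contraction. -/

namespace SmoothingEquation

variable {Ω : Type*} [MeasurableSpace Ω] {ν : Measure Ω} {ρ : Ω → ℝ}

/-- The equation `F s = ∫ F (s ρ) ^ 2` at the point `s`. -/
def SolvesAt (ν : Measure Ω) (ρ : Ω → ℝ) (F : ℝ → ℝ) (s : ℝ) : Prop :=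
  Integrable (fun w => F (s * ρ w) ^ 2) ν ∧ F s = ∫ w, F (s * ρ w) ^ 2 ∂ν

variable [IsProbabilityMeasure ν]

/-- Writing `F ^ 2 - G ^ 2 = (F + G) * (F - G)`, each use of the equation multiplies the bound `K *
s ^ a` by `B * E[ρ ^ a] < 1`. The interval is preserved because `ρ < 1`. -/
theorem IsSplitting.eqOn_Ioc (h : IsSplitting ν ρ) {F G : ℝ → ℝ} {S a B K : ℝ} (ha : 0 ≤ a)
    (hF : ∀ s ∈ Ioc 0 S, SolvesAt ν ρ F s) (hG : ∀ s ∈ Ioc 0 S, SolvesAt ν ρ G s)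
    (hB : ∀ s ∈ Ioc 0 S, |F s + G s| ≤ B) (hK : ∀ s ∈ Ioc 0 S, |F s - G s| ≤ K * s ^ a)
    (hlt : B * ∫ w, ρ w ^ a ∂ν < 1) : EqOn F G (Ioc 0 S) := by
  intro s hs
  set m := ∫ w, ρ w ^ a ∂ν with hm
  have hB0 : 0 ≤ B := (abs_nonneg _).trans (hB s hs)
  have hm0 : 0 ≤ m := h.moment_nonneg a
  have key : ∀ n : ℕ, ∀ t ∈ Ioc 0 S, |F t - G t| ≤ K * (B * m) ^ n * t ^ a := by
    intro n
    induction n with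
    | zero => simpa using hK
    | succ n ih =>
      intro t ht
      rw [(hF t ht).2, (hG t ht).2, ← integral_sub (hF t ht).1 (hG t ht).1]
      have hb : Integrable (fun w => B * (K * (B * m) ^ n * t ^ a) * ρ w ^ a) ν :=
        (h.integrable_rpow ha).const_mul _
      have := norm_integral_le_of_norm_le hb
        (f := fun w => F (t * ρ w) ^ 2 - G (t * ρ w) ^ 2) (by
          filter_upwards [h.mem] with w hw
          have htw : t * ρ w ∈ Ioc 0 S :=
            ⟨mul_pos ht.1 hw.1, (mul_le_of_le_one_right ht.1.le hw.2.le).trans ht.2⟩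
          rw [sq_sub_sq, norm_mul, Real.norm_eq_abs, Real.norm_eq_abs]
          refine (mul_le_mul (hB _ htw) (ih _ htw) (abs_nonneg _) hB0).trans_eq ?_
          rw [Real.mul_rpow ht.1.le hw.1.le]
          ring)
      rw [integral_const_mul, ← hm, Real.norm_eq_abs] at this
      refine this.trans_eq ?_
      ring
  have hlim : Tendsto (fun n : ℕ => K * (B * m) ^ n * s ^ a) atTop (𝓝 0) := by
    simpa using ((tendsto_pow_atTop_nhds_zero_of_lt_one (mul_nonneg hB0 hm0) hlt).const_mul
      K).mul_const (s ^ a)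
  exact sub_eq_zero.1 (abs_nonpos_iff.1 (ge_of_tendsto' hlim fun n => key n s hs))

theorem IsSplitting.exists_bound (h : IsSplitting ν ρ) {a : ℝ} (ha : 1 < a) :
    ∃ B : ℝ, 2 < B ∧ B * ∫ w, ρ w ^ a ∂ν < 1 := by
  have h1 := h.moment_lt_half ha
  have h0 := h.moment_nonneg a
  -- With `m` the moment, `(3 - 2 * m) * m < 1` is equivalent to `(1 - m) * (1 - 2 * m) > 0`.
  exact ⟨2 + (1 - 2 * ∫ w, ρ w ^ a ∂ν), by linarith, by nlinarith⟩

theorem IsSplitting.eqOn_Ioi (h : IsSplitting ν ρ) {F G : ℝ → ℝ} {a : ℝ} (ha : 1 < a)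
    (hF : ∀ s, 0 < s → SolvesAt ν ρ F s) (hG : ∀ s, 0 < s → SolvesAt ν ρ G s)
    (bF : ∀ S, ∃ B, ∀ s ∈ Ioc 0 S, |F s| ≤ B) (bG : ∀ S, ∃ B, ∀ s ∈ Ioc 0 S, |G s| ≤ B)
    (hF1 : Tendsto F (𝓝[>] 0) (𝓝 1)) (hG1 : Tendsto G (𝓝[>] 0) (𝓝 1))
    (hO : (fun s => F s - G s) =O[𝓝[>] 0] fun s => s ^ a) : EqOn F G (Ioi 0) := by
  obtain ⟨B, hB2, hB⟩ := h.exists_bound ha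
  obtain ⟨K, hK⟩ := hO.bound
  have hsum : ∀ᶠ s in 𝓝[>] (0 : ℝ), |F s + G s| < B :=
    (hF1.add hG1).abs.eventually_lt_const (by norm_num; exact hB2)
  obtain ⟨r, hr, hsub⟩ := mem_nhdsGT_iff_exists_Ioc_subset.1 (hsum.and hK)
  rw [mem_Ioi] at hr
  have hnear : EqOn F G (Ioc 0 r) :=
    h.eqOn_Ioc (zero_le_one.trans ha.le) (fun s hs => hF s hs.1) (fun s hs => hG s hs.1)
      (fun s hs => (hsub hs).1.le) (K := K) (fun s hs => by
        simpa [abs_of_nonneg (Real.rpow_nonneg hs.1.le a)] using (hsub hs).2) hB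
  intro S hS
  obtain ⟨B₁, hB₁⟩ := bF S
  obtain ⟨B₂, hB₂⟩ := bG S
  have hS' : S ∈ Ioc 0 S := ⟨hS, le_rfl⟩
  have hB0 : 0 ≤ B₁ + B₂ :=
    add_nonneg ((abs_nonneg _).trans (hB₁ S hS')) ((abs_nonneg _).trans (hB₂ S hS'))
  -- On `(0, S]` the sum is merely bounded, but the difference vanishes on `(0, r]` and is therefore
  -- `O(s ^ n)` for every `n`. A large `n` makes the moment small enough to beat any bound.
  have hlim : Tendsto (fun n : ℕ => (B₁ + B₂) * ∫ w, ρ w ^ (n : ℝ) ∂ν) atTop (𝓝 0) := by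
    simpa using h.tendsto_moment.const_mul (B₁ + B₂)
  obtain ⟨n, hn⟩ := (hlim.eventually_lt_const zero_lt_one).exists
  refine h.eqOn_Ioc (n.cast_nonneg) (fun s hs => hF s hs.1) (fun s hs => hG s hs.1)
    (fun s hs => (abs_add_le _ _).trans (add_le_add (hB₁ s hs) (hB₂ s hs)))
    (K := (B₁ + B₂) / r ^ (n : ℝ)) (fun s hs => ?_) hn hS'
  rcases le_total s r with hsr | hsr
  · rw [hnear ⟨hs.1, hsr⟩, sub_self, abs_zero]
    exact mul_nonneg (div_nonneg hB0 (Real.rpow_nonneg hr.le _)) (Real.rpow_nonneg hs.1.le _)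
  · rw [div_mul_eq_mul_div, le_div_iff₀ (Real.rpow_pos_of_pos hr _)]
    exact mul_le_mul ((abs_sub _ _).trans (add_le_add (hB₁ s hs) (hB₂ s hs)))
      (Real.rpow_le_rpow hr.le hsr n.cast_nonneg) (Real.rpow_nonneg hr.le _) hB0

end SmoothingEquation

/-! ### The power series solution and smoothness at the origin. -/

namespace SmoothingEquation

/-- If `1 - s ∑ bₙ sⁿ` solves the equation whose factor has the moments `m`, then `b` is given by
this recursion. -/
noncomputable def coeff (m : ℕ → ℝ) : ℕ → ℝ
  | 0 => 1
  | n + 1 => -(m (n + 2) / (1 - 2 * m (n + 2))) * ∑ i : Fin (n + 1), coeff m i * coeff m (n - i)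

theorem coeff_succ (m : ℕ → ℝ) (n : ℕ) : coeff m (n + 1) = -(m (n + 2) / (1 - 2 * m (n + 2))) *
    ∑ k ∈ Finset.HasAntidiagonal.antidiagonal n, coeff m k.1 * coeff m k.2 := by
  rw [coeff, Finset.Nat.sum_antidiagonal_eq_sum_range_succ (fun i j => coeff m i * coeff m j),
    Finset.sum_range]

theorem catalan_le_four_pow (n : ℕ) : catalan n ≤ 4 ^ n := by
  rw [catalan_eq_centralBinom_div]
  exact (Nat.div_le_self _ _).trans n.centralBinom_le_four_pow

/-- With the ratios replaced by their bound `A`, the recursion becomes that of the Catalan numbers,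
so `A ^ n * catalan n` is a majorant. -/
theorem abs_coeff_le {m : ℕ → ℝ} {A : ℝ}
    (hA : ∀ n, |m (n + 2) / (1 - 2 * m (n + 2))| ≤ A) (n : ℕ) :
    |coeff m n| ≤ (4 * A) ^ n := by
  have hA0 : 0 ≤ A := (abs_nonneg _).trans (hA 0)
  have key : |coeff m n| ≤ A ^ n * catalan n := by
    induction n using Nat.strong_induction_on with
    | _ n ih =>
      cases n with
      | zero => simp [coeff]
      | succ n =>
        rw [coeff_succ, abs_mul, abs_neg, pow_succ', mul_assoc, catalan_succ']
        refine mul_le_mul (hA n) ?_ (abs_nonneg _) hA0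
        refine (Finset.abs_sum_le_sum_abs _ _).trans ?_
        push_cast
        rw [Finset.mul_sum]
        refine Finset.sum_le_sum fun k hk => ?_
        have hk' := Finset.HasAntidiagonal.mem_antidiagonal.1 hk
        rw [abs_mul, ← hk', pow_add]
        refine (mul_le_mul (ih k.1 (by omega)) (ih k.2 (by omega)) (abs_nonneg _)
          (by positivity)).trans_eq ?_
        ring
  refine key.trans ?_
  rw [mul_pow, mul_comm]
  gcongr
  exact_mod_cast catalan_le_four_pow n

variable {Ω : Type*} [MeasurableSpace Ω] {ν : Measure Ω} {ρ : Ω → ℝ}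

theorem IsSplitting.moment_nat_nonneg (h : IsSplitting ν ρ) (n : ℕ) : 0 ≤ ∫ w, ρ w ^ n ∂ν := by
  simpa using h.moment_nonneg n

variable [IsProbabilityMeasure ν]

theorem IsSplitting.moment_add_two_le (h : IsSplitting ν ρ) (n : ℕ) :
    ∫ w, ρ w ^ (n + 2) ∂ν ≤ ∫ w, ρ w ^ 2 ∂ν := by
  refine integral_mono_ae (h.integrable_pow _) (h.integrable_pow _) ?_
  filter_upwards [h.mem] with w hw
  exact pow_le_pow_of_le_one hw.1.le hw.2.le (by omega)

theorem IsSplitting.exists_coeff_bound (h : IsSplitting ν ρ) :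
    ∃ R : ℝ, 0 < R ∧ ∀ n, |coeff (fun k => ∫ w, ρ w ^ k ∂ν) n| ≤ R ^ n := by
  set m : ℕ → ℝ := fun k => ∫ w, ρ w ^ k ∂ν with hm
  have h2 : m 2 < 1 / 2 := h.sq_moment_lt_half
  have h0 : 0 ≤ m 2 := h.moment_nat_nonneg 2
  -- The moments decrease and `m 2 < 1 / 2`, so the denominators stay away from zero uniformly.
  have hA : ∀ n, |m (n + 2) / (1 - 2 * m (n + 2))| ≤ m 2 / (1 - 2 * m 2) := fun n => by
    have h3 : m (n + 2) ≤ m 2 := h.moment_add_two_le n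
    have h4 : 0 ≤ m (n + 2) := h.moment_nat_nonneg _
    rw [abs_of_nonneg (div_nonneg h4 (by linarith))]
    exact div_le_div₀ h0 h3 (by linarith) (by linarith)
  have hpos : 0 ≤ m 2 / (1 - 2 * m 2) := div_nonneg h0 (by linarith)
  refine ⟨4 * (m 2 / (1 - 2 * m 2)) + 1, by positivity, fun n => (abs_coeff_le hA n).trans ?_⟩
  gcongr
  linarith

/-- Termwise integration of a power series of the factor. -/
theorem IsSplitting.integral_tsum_pow (h : IsSplitting ν ρ) {c : ℕ → ℝ}
    (hc : Summable fun n => |c n|) (k : ℕ) :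
    Integrable (fun w => ∑' n, c n * ρ w ^ (n + k)) ν ∧
      ∫ w, ∑' n, c n * ρ w ^ (n + k) ∂ν = ∑' n, c n * ∫ w, ρ w ^ (n + k) ∂ν := by
  have hle : ∀ᵐ w ∂ν, ∀ n, ‖c n * ρ w ^ (n + k)‖ ≤ |c n| := by
    filter_upwards [h.mem] with w hw n
    rw [norm_mul, Real.norm_eq_abs, Real.norm_of_nonneg (pow_nonneg hw.1.le _)]
    exact mul_le_of_le_one_right (abs_nonneg _) (pow_le_one₀ hw.1.le hw.2.le)
  constructor
  · refine Integrable.of_bound (Measurable.tsum fun n =>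
      (h.measurable.pow_const _).const_mul _).aestronglyMeasurable (∑' n, |c n|) ?_
    filter_upwards [hle] with w hw
    exact tsum_of_norm_bounded hc.hasSum hw
  · have := hasSum_integral_of_summable_integral_norm (μ := ν)
      (F := fun n w => c n * ρ w ^ (n + k)) (fun n => (h.integrable_pow _).const_mul _)
      (hc.of_nonneg_of_le (fun n => integral_nonneg fun _ => norm_nonneg _) fun n => by
        have := norm_integral_le_of_norm_le_const (μ := ν) (C := |c n|)
          (f := fun w => ‖c n * ρ w ^ (n + k)‖) (hle.mono fun w hw => by
            rw [norm_norm]; exact hw n)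
        simp only [probReal_univ, mul_one] at this
        exact (le_abs_self _).trans this)
    rw [← this.tsum_eq]
    simp only [integral_const_mul]

/-- The power series with the coefficients `coeff` solves the equation near the origin. -/
theorem IsSplitting.solvesAt_powerSeries (h : IsSplitting ν ρ) {s : ℝ}
    (hs : Summable fun n => |coeff (fun k => ∫ w, ρ w ^ k ∂ν) n * s ^ n|) :
    SolvesAt ν ρ (fun t => 1 - t * ∑' n, coeff (fun k => ∫ w, ρ w ^ k ∂ν) n * t ^ n) s := by
  set m : ℕ → ℝ := fun k => ∫ w, ρ w ^ k ∂ν with hm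
  set b := coeff m with hb
  set d : ℕ → ℝ := fun n => ∑ k ∈ Finset.HasAntidiagonal.antidiagonal n, b k.1 * b k.2 with hd
  have hdn : ∀ (t : ℝ) (n : ℕ), ∑ k ∈ Finset.HasAntidiagonal.antidiagonal n, b k.1 * t ^ k.1 * (b k.2 * t ^ k.2) =
      d n * t ^ n := fun t n => by
    rw [hd, Finset.sum_mul]
    refine Finset.sum_congr rfl fun k hk => ?_
    rw [← Finset.HasAntidiagonal.mem_antidiagonal.1 hk, pow_add]
    ring
  have hds : Summable fun n => |d n * s ^ n| := by
    simpa only [hdn, Real.norm_eq_abs] using summable_norm_sum_mul_antidiagonal_of_summable_norm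
      (f := fun n => b n * s ^ n) (g := fun n => b n * s ^ n) hs hs
  obtain ⟨i1, e1⟩ := h.integral_tsum_pow hs 1
  obtain ⟨i2, e2⟩ := h.integral_tsum_pow hds 2
  have hpt : ∀ᵐ w ∂ν, (1 - s * ρ w * ∑' n, b n * (s * ρ w) ^ n) ^ 2 =
      1 - 2 * s * ∑' n, b n * s ^ n * ρ w ^ (n + 1) +
        s ^ 2 * ∑' n, d n * s ^ n * ρ w ^ (n + 2) := by
    filter_upwards [h.mem] with w hw
    have hsw : Summable fun n => ‖b n * (s * ρ w) ^ n‖ :=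
      hs.of_nonneg_of_le (fun _ => norm_nonneg _) fun n => by
        rw [mul_pow, ← mul_assoc, norm_mul, Real.norm_eq_abs,
          Real.norm_of_nonneg (pow_nonneg hw.1.le n)]
        exact mul_le_of_le_one_right (abs_nonneg _) (pow_le_one₀ hw.1.le hw.2.le)
    have t1 : ∑' n, b n * s ^ n * ρ w ^ (n + 1) = ρ w * ∑' n, b n * (s * ρ w) ^ n := by
      rw [← tsum_mul_left]
      exact tsum_congr fun n => by rw [mul_pow]; ring
    have t2 : ∑' n, d n * s ^ n * ρ w ^ (n + 2) =
        ρ w ^ 2 * ((∑' n, b n * (s * ρ w) ^ n) * ∑' n, b n * (s * ρ w) ^ n) := by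
      rw [tsum_mul_tsum_eq_tsum_sum_antidiagonal_of_summable_norm hsw hsw, ← tsum_mul_left]
      exact tsum_congr fun n => by rw [hdn, mul_pow]; ring
    rw [t1, t2]
    ring
  have j1 : Integrable (fun w => 1 - 2 * s * ∑' n, b n * s ^ n * ρ w ^ (n + 1)) ν :=
    (integrable_const (1 : ℝ)).sub (i1.const_mul _)
  have j2 : Integrable (fun w => s ^ 2 * ∑' n, d n * s ^ n * ρ w ^ (n + 2)) ν := i2.const_mul _
  refine ⟨(j1.add j2).congr (hpt.mono fun w hw => hw.symm), ?_⟩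
  rw [integral_congr_ae hpt, integral_add j1 j2, integral_sub (integrable_const _)
    (i1.const_mul _), integral_const_mul, integral_const_mul, e1, e2]
  have hm1 : m 1 = 1 / 2 := by simp [hm, h.mean]
  -- Comparison of the coefficients of `s ^ (n + 2)` in the equation. At order `s` there is no
  -- constraint on `b 0`, because `2 * m 1 = 1`.
  have hrec : ∀ n, b (n + 1) = 2 * (b (n + 1) * m (n + 2)) - m (n + 2) * d n := fun n => by
    have h3 : m (n + 2) ≤ m 2 := h.moment_add_two_le n
    have h2 : m 2 < 1 / 2 := h.sq_moment_lt_half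
    have h4 : 1 - 2 * m (n + 2) ≠ 0 := by linarith
    have : b (n + 1) = -(m (n + 2) / (1 - 2 * m (n + 2))) * d n := coeff_succ m n
    have h5 : b (n + 1) * (1 - 2 * m (n + 2)) = -(m (n + 2) * d n) := by
      rw [this, neg_mul, neg_mul, mul_right_comm, div_mul_cancel₀ _ h4]
    linarith
  have hmle : ∀ n, |m (n + 1)| ≤ 1 := fun n => by
    rw [abs_of_nonneg (h.moment_nat_nonneg _)]
    have := integral_mono_ae (h.integrable_pow (n + 1)) (integrable_const (1 : ℝ))
      (h.mem.mono fun w hw => pow_le_one₀ hw.1.le hw.2.le)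
    simpa using this
  have s1 : Summable fun n => b n * s ^ n * m (n + 1) :=
    Summable.of_norm_bounded hs fun n => by
      rw [norm_mul]
      exact mul_le_of_le_one_right (norm_nonneg _) (hmle n)
  have s2 : Summable fun n => d n * s ^ n * m (n + 2) :=
    Summable.of_norm_bounded hds fun n => by
      rw [norm_mul]
      exact mul_le_of_le_one_right (norm_nonneg _) (hmle (n + 1))
  have hQ : ∑' n, b n * s ^ n =
      2 * ∑' n, b n * s ^ n * m (n + 1) - s * ∑' n, d n * s ^ n * m (n + 2) := by
    rw [hs.of_abs.tsum_eq_zero_add, s1.tsum_eq_zero_add, mul_add, ← tsum_mul_left,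
      ← tsum_mul_left, add_sub_assoc, ← Summable.tsum_sub]
    · congr 1
      · simp only [zero_add, hm1, pow_zero]
        ring
      · refine tsum_congr fun n => ?_
        nth_rw 1 [hrec n]
        ring
    · exact ((summable_nat_add_iff 1).2 s1).mul_left 2
    · exact s2.mul_left s
  change 1 - s * ∑' n, b n * s ^ n = _
  rw [hQ]
  simp only [integral_const, probReal_univ, smul_eq_mul]
  ring

theorem IsSplitting.exists_local_solution (h : IsSplitting ν ρ) :
    ∃ (P : ℝ → ℝ) (r K : ℝ), 0 < r ∧ P 0 = 1 ∧ (∀ s ∈ Icc 0 r, ContDiffAt ℝ ∞ P s) ∧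
      (∀ s ∈ Ioc 0 r, SolvesAt ν ρ P s) ∧ ∀ s ∈ Ioc 0 r, |P s - (1 - s)| ≤ K * s ^ 2 := by
  obtain ⟨R, hR, hb⟩ := h.exists_coeff_bound
  set b := coeff (fun k => ∫ w, ρ w ^ k ∂ν) with hbdef
  set Q : ℝ → ℝ := fun t => ∑' n, b n * t ^ n with hQ
  set p := FormalMultilinearSeries.ofScalars ℝ b with hp
  have hrad : ENNReal.ofReal (1 / R) ≤ p.radius := by
    refine p.le_radius_of_bound 1 fun n => ?_
    rw [hp, FormalMultilinearSeries.ofScalars_norm, Real.coe_toNNReal _ (by positivity),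
      Real.norm_eq_abs]
    calc |b n| * (1 / R) ^ n ≤ R ^ n * (1 / R) ^ n := by gcongr; exact hb n
      _ = 1 := by rw [← mul_pow, mul_one_div_cancel hR.ne', one_pow]
  have hrad0 : 0 < p.radius := lt_of_lt_of_le (by simpa using hR) hrad
  have hQan : ∀ s ∈ Icc 0 (1 / (2 * R)), AnalyticAt ℝ Q s := fun s hs => by
    have hsum : p.sum = Q := by
      have := FormalMultilinearSeries.ofScalarsSum_eq_tsum (E := ℝ) b
      simpa [FormalMultilinearSeries.ofScalarsSum] using this
    rw [← hsum]
    refine (p.hasFPowerSeriesOnBall hrad0).analyticOnNhd s ?_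
    refine Metric.eball_subset_eball hrad ?_
    rw [Metric.eball_ofReal, Metric.mem_ball, Real.dist_0_eq_abs, abs_of_nonneg hs.1]
    exact hs.2.trans_lt (by gcongr; linarith)
  have hQ0 : Q 0 = 1 := by
    rw [hQ]
    simp only
    rw [tsum_eq_single 0 fun n hn => by simp [hn]]
    simp [hbdef, coeff]
  have hO : (fun s => Q s - 1) =O[𝓝 0] fun s => s := by
    simpa [hQ0] using
      (hQan 0 ⟨le_rfl, by positivity⟩).differentiableAt.isBigO_sub
  obtain ⟨K, hK⟩ := hO.bound
  obtain ⟨e, he, heK⟩ := Metric.eventually_nhds_iff.1 hK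
  have hr1 : min (1 / (2 * R)) (e / 2) ≤ 1 / (2 * R) := min_le_left _ _
  have hr2 : min (1 / (2 * R)) (e / 2) ≤ e / 2 := min_le_right _ _
  -- Half of `1 / R` stays strictly inside the disc of convergence; half of `e` stays inside the
  -- ball where `|Q s - 1| ≤ K * |s|`.
  refine ⟨fun s => 1 - s * Q s, min (1 / (2 * R)) (e / 2), K, by positivity, by simp, ?_, ?_, ?_⟩
  · intro s hs
    exact contDiffAt_const.sub (contDiffAt_id.mul (hQan s ⟨hs.1, hs.2.trans hr1⟩).contDiffAt)
  · intro s hs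
    refine h.solvesAt_powerSeries ?_
    have hsR : |s * R| < 1 := by
      rw [abs_of_pos (mul_pos hs.1 hR)]
      have : s * R ≤ 1 / (2 * R) * R := by gcongr; exact hs.2.trans hr1
      have h2 : 1 / (2 * R) * R = 1 / 2 := by field_simp
      linarith
    refine (summable_geometric_of_abs_lt_one hsR).abs.of_nonneg_of_le (fun _ => abs_nonneg _)
      fun n => ?_
    rw [abs_mul, mul_pow, abs_mul, mul_comm, abs_of_pos (pow_pos hR n)]
    gcongr
    exact hb n
  · intro s hs
    have h1 : |Q s - 1| ≤ K * s := by
      have := @heK s (by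
        rw [Real.dist_0_eq_abs, abs_of_pos hs.1]
        linarith [hs.2])
      rwa [Real.norm_eq_abs, Real.norm_of_nonneg hs.1.le] at this
    rw [show 1 - s * Q s - (1 - s) = -(s * (Q s - 1)) by ring, abs_neg, abs_mul, abs_of_pos hs.1]
    nlinarith [hs.1]

theorem tendsto_one_of_quadratic {F : ℝ → ℝ} {K r : ℝ} (hr : 0 < r)
    (hF : ∀ s ∈ Ioc 0 r, |F s - (1 - s)| ≤ K * s ^ 2) : Tendsto F (𝓝[>] 0) (𝓝 1) := by
  have h1 : Tendsto (fun s : ℝ => K * s ^ 2) (𝓝[>] 0) (𝓝 0) := by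
    have : Continuous fun s : ℝ => K * s ^ 2 := by fun_prop
    simpa using (this.tendsto 0).mono_left nhdsWithin_le_nhds
  have h2 : Tendsto (fun s : ℝ => 1 - s) (𝓝[>] 0) (𝓝 1) := by
    have : Continuous fun s : ℝ => 1 - s := by fun_prop
    simpa using (this.tendsto 0).mono_left nhdsWithin_le_nhds
  have h3 : Tendsto (fun s => F s - (1 - s)) (𝓝[>] 0) (𝓝 0) :=
    squeeze_zero_norm' (by
      filter_upwards [Ioc_mem_nhdsGT hr] with s hs using hF s hs) h1
  simpa using h3.add h2

/-- A solution with the expansion `1 - s + O(s ^ 2)` is smooth up to the origin. -/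
theorem IsSplitting.contDiffWithinAt_zero (h : IsSplitting ν ρ) {F : ℝ → ℝ} {K : ℝ}
    (hF : ∀ s, 0 < s → SolvesAt ν ρ F s) (hF0 : F 0 = 1)
    (hK : ∀ s, 0 ≤ s → |F s - (1 - s)| ≤ K * s ^ 2) : ContDiffWithinAt ℝ ∞ F (Ici 0) 0 := by
  obtain ⟨P, r, L, hr, hP0, hPs, hPsol, hPL⟩ := h.exists_local_solution
  obtain ⟨B, hB2, hB⟩ := h.exists_bound one_lt_two
  have hsum : ∀ᶠ s in 𝓝[>] (0 : ℝ), |F s + P s| < B :=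
    ((tendsto_one_of_quadratic hr fun s hs => hK s hs.1.le).add
      (tendsto_one_of_quadratic hr hPL)).abs.eventually_lt_const (by norm_num; exact hB2)
  obtain ⟨u, hu, hsub⟩ := mem_nhdsGT_iff_exists_Ioc_subset.1
    (hsum.and (Ioc_mem_nhdsGT hr))
  have heq : EqOn F P (Ioc 0 u) := by
    refine h.eqOn_Ioc (a := 2) (K := K + L) zero_le_two (fun s hs => hF s hs.1)
      (fun s hs => hPsol s (hsub hs).2) (fun s hs => (hsub hs).1.le) (fun s hs => ?_) hB
    have h1 := abs_le.1 (hK s hs.1.le)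
    have h2 := abs_le.1 (hPL s (hsub hs).2)
    rw [Real.rpow_two, abs_le]
    constructor <;> linarith [h1.1, h1.2, h2.1, h2.2]
  refine (hPs 0 ⟨le_rfl, hr.le⟩).contDiffWithinAt.congr_of_eventuallyEq ?_ (hF0.trans hP0.symm)
  filter_upwards [Ico_mem_nhdsGE hu] with s hs
  rcases hs.1.eq_or_lt with h0 | h0
  · rw [← h0, hF0, hP0]
  · exact heq ⟨h0, hs.2.le⟩

end SmoothingEquation

/-! ### The exponent, the law of the factor and the reduction of the scaling equation. -/

namespace DiagonalAggregation

open SmoothingEquation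

theorem two_rpow_lt_one {lam : ℝ} (hlam : lam < 1) : (2 : ℝ) ^ (lam - 1) < 1 :=
  Real.rpow_lt_one_of_one_lt_of_neg one_lt_two (by linarith)

theorem psiZero_pos {lam : ℝ} (hlam : lam < 1) : 0 < psiZero lam :=
  div_pos (by linarith) (by linarith [two_rpow_lt_one hlam])

/-- The exponent equation says that a strictly convex function meets a chord through `0`. -/
theorem exponentEquation_iff {lam : ℝ} (hlam : lam < 1) (Δ : ℝ) : ExponentEquation lam Δ ↔
    Real.exp (Real.log 2 * (lam - 1) * (Δ + 1)) =
      1 - (1 - (2 : ℝ) ^ (lam - 1)) / 2 * (Δ + 1) := by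
  have hq : 1 - (2 : ℝ) ^ (lam - 1) ≠ 0 := by linarith [two_rpow_lt_one hlam]
  rw [ExponentEquation, Real.rpow_def_of_pos two_pos ((lam - 1) * (Δ + 1)), eq_div_iff hq,
    mul_assoc]
  constructor <;> intro h <;> linarith

theorem exists_exponent {lam : ℝ} (hlam : lam < 1) : ∃ Δ : ℝ, 0 < Δ ∧ ExponentEquation lam Δ ∧
    ∀ Δ' : ℝ, 0 < Δ' → ExponentEquation lam Δ' → Δ' = Δ := by
  set q := (2 : ℝ) ^ (lam - 1) with hq
  have hq0 : 0 < q := Real.rpow_pos_of_pos two_pos _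
  have hq1 : q < 1 := two_rpow_lt_one hlam
  set l := Real.log 2 * (lam - 1) with hl
  have hl0 : l < 0 := mul_neg_of_pos_of_neg (Real.log_pos one_lt_two) (by linarith)
  have hql : Real.exp l = q := by rw [hq, Real.rpow_def_of_pos two_pos]
  set f : ℝ → ℝ := fun x => Real.exp (l * (x + 1)) - (1 - (1 - q) / 2 * (x + 1)) with hf
  have hiff : ∀ x, ExponentEquation lam x ↔ f x = 0 := fun x => by
    rw [exponentEquation_iff hlam, hf, sub_eq_zero]
  have hcont : Continuous f := by fun_prop
  -- The strictly convex `f` also vanishes at `-1`, and it cannot have three zeros.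
  have huniq : ∀ x y, 0 < x → x < y → f x = 0 → f y = 0 → False := fun x y hx hxy h1 h2 => by
    have := strictConvexOn_exp.2 (mem_univ 0) (mem_univ (l * (y + 1)))
      (mul_ne_zero hl0.ne (by linarith)).symm
      (show 0 < 1 - (x + 1) / (y + 1) by rw [sub_pos, div_lt_one] <;> linarith)
      (show 0 < (x + 1) / (y + 1) from div_pos (by linarith) (by linarith)) (by ring)
    have e1 : (x + 1) / (y + 1) * (l * (y + 1)) = l * (x + 1) := by
      have hy : y + 1 ≠ 0 := by linarith
      field_simp
    have e2 : (x + 1) / (y + 1) * (y + 1) = x + 1 := div_mul_cancel₀ _ (by linarith)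
    simp only [smul_eq_mul, mul_zero, zero_add, Real.exp_zero, mul_one, e1] at this
    simp only [hf, sub_eq_zero] at h1 h2
    rw [h1, h2] at this
    nlinarith
  have hf0 : f 0 < 0 := by
    simp only [hf, zero_add, mul_one, hql]
    linarith
  -- At this point the affine part equals `-(1 - q) / 2`, so `f` is positive.
  have hM : 0 ≤ f (2 / (1 - q)) := by
    have h1 : (1 - q) / 2 * (2 / (1 - q) + 1) = 1 + (1 - q) / 2 := by
      have : 1 - q ≠ 0 := by linarith
      field_simp
    simp only [hf, h1]
    linarith [Real.exp_pos (l * (2 / (1 - q) + 1))]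
  have hM0 : 0 ≤ 2 / (1 - q) := div_nonneg zero_le_two (by linarith)
  obtain ⟨x, hx, hfx⟩ := intermediate_value_Icc hM0 hcont.continuousOn ⟨hf0.le, hM⟩
  have hx0 : 0 < x := hx.1.lt_of_ne (by rintro rfl; exact hf0.ne hfx)
  refine ⟨x, hx0, (hiff x).2 hfx, fun y hy hfy => ?_⟩
  rw [hiff] at hfy
  rcases lt_trichotomy x y with h | h | h
  · exact (huniq x y hx0 h hfx hfy).elim
  · exact h.symm
  · exact (huniq y x hy h hfy hfx).elim

/-- A decreasing function with `h (2 x) ≤ h x ^ 2` decays exponentially. -/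
theorem exists_exp_bound {h : ℝ → ℝ} (hanti : AntitoneOn h (Ici 0)) (hpos : ∀ x, 0 ≤ x → 0 < h x)
    (hle : ∀ x, 0 ≤ x → h x ≤ 1) (hdouble : ∀ x, 0 ≤ x → h (2 * x) ≤ h x ^ 2)
    {x₀ : ℝ} (hx₀ : 0 < x₀) (hlt : h x₀ < 1) :
    ∃ C a : ℝ, 0 < C ∧ 0 < a ∧ ∀ x ∈ Ici (0 : ℝ), h x ≤ C * Real.exp (-(a * x)) := by
  set L := -Real.log (h x₀) with hL
  have hL0 : 0 < L := neg_pos.2 (Real.log_neg (hpos _ hx₀.le) hlt)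
  have hexp : h x₀ = Real.exp (-L) := by rw [hL, neg_neg, Real.exp_log (hpos _ hx₀.le)]
  have hpow : ∀ n : ℕ, h (2 ^ n * x₀) ≤ Real.exp (-(2 ^ n * L)) := fun n => by
    induction n with
    | zero => simp [hexp]
    | succ n ih =>
      have h0 : 0 ≤ 2 ^ n * x₀ := by positivity
      rw [pow_succ', mul_assoc]
      refine (hdouble _ h0).trans ((pow_le_pow_left₀ (hpos _ h0).le ih 2).trans_eq ?_)
      rw [← Real.exp_nat_mul]
      congr 1
      push_cast
      ring
  -- For `x ≥ x₀`, choosing `2 ^ n ≤ x / x₀ < 2 ^ (n + 1)` costs a factor `2` in the rate. The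
  -- prefactor `exp (L / 2)` covers `x < x₀`, where only `h x ≤ 1` is available.
  refine ⟨Real.exp (L / 2), L / (2 * x₀), Real.exp_pos _, by positivity, fun x hx => ?_⟩
  rw [← Real.exp_add]
  rcases lt_or_ge x x₀ with hxx | hxx
  · refine (hle x hx).trans (Real.one_le_exp ?_)
    have : L / (2 * x₀) * x = L / 2 * (x / x₀) := by field_simp
    rw [this]
    have h1 : x / x₀ ≤ 1 := (div_le_one hx₀).2 hxx.le
    nlinarith
  · obtain ⟨n, hn1, hn2⟩ := exists_nat_pow_near ((one_le_div hx₀).2 hxx) one_lt_two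
    rw [le_div_iff₀ hx₀] at hn1
    refine (hanti (mem_Ici.2 (by positivity)) hx hn1).trans ((hpow n).trans ?_)
    rw [Real.exp_le_exp]
    have : L / (2 * x₀) * x = L / 2 * (x / x₀) := by field_simp
    rw [this]
    rw [pow_succ] at hn2
    nlinarith

/-- The law on `(1/2, 1]` whose averages appear in the scaling equation. -/
noncomputable def factorMeasure (lam : ℝ) : Measure ℝ :=
  (volume.restrict (Ioc (1 / 2) 1)).withDensity fun z => ENNReal.ofReal (psiZero lam * z ^ (-lam))

theorem measurable_density (lam : ℝ) :
    Measurable fun z : ℝ => (psiZero lam * z ^ (-lam)).toNNReal :=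
  ((measurable_id.pow_const _).const_mul _).real_toNNReal

theorem density_nonneg {lam : ℝ} (hlam : lam < 1) {z : ℝ} (hz : z ∈ Ioc (1 / 2 : ℝ) 1) :
    0 ≤ psiZero lam * z ^ (-lam) :=
  mul_nonneg (psiZero_pos hlam).le (Real.rpow_nonneg (by linarith [hz.1]) _)

theorem integrable_factorMeasure_iff {lam : ℝ} (hlam : lam < 1) (g : ℝ → ℝ) :
    Integrable g (factorMeasure lam) ↔
      IntegrableOn (fun z => psiZero lam * z ^ (-lam) * g z) (Ioc (1 / 2) 1) := by
  refine (integrable_withDensity_iff_integrable_smul (measurable_density lam)).trans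
    (integrableOn_congr_fun (fun z hz => ?_) measurableSet_Ioc)
  simp only [NNReal.smul_def, smul_eq_mul, Real.coe_toNNReal _ (density_nonneg hlam hz)]

theorem integral_factorMeasure {lam : ℝ} (hlam : lam < 1) (g : ℝ → ℝ) :
    ∫ z, g z ∂(factorMeasure lam) = ∫ z in Ioc (1 / 2) 1, psiZero lam * z ^ (-lam) * g z := by
  refine (integral_withDensity_eq_integral_smul (measurable_density lam) g).trans
    (setIntegral_congr_fun measurableSet_Ioc fun z hz => ?_)
  simp only [NNReal.smul_def, smul_eq_mul, Real.coe_toNNReal _ (density_nonneg hlam hz)]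

theorem ae_factorMeasure (lam : ℝ) : ∀ᵐ z ∂(factorMeasure lam), z ∈ Ioo (1 / 2 : ℝ) 1 := by
  refine (withDensity_absolutelyContinuous _ _).ae_le ?_
  rw [← Measure.restrict_congr_set Ioo_ae_eq_Ioc]
  exact ae_restrict_mem measurableSet_Ioo

theorem setIntegral_rpow {r : ℝ} (hr : -1 < r) :
    ∫ z in Ioc (1 / 2 : ℝ) 1, z ^ r = (1 - (2 : ℝ) ^ (-(r + 1))) / (r + 1) := by
  rw [← intervalIntegral.integral_of_le (by norm_num), integral_rpow (Or.inl hr), Real.one_rpow,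
    one_div, Real.inv_rpow zero_le_two, Real.rpow_neg zero_le_two]

theorem integrableOn_rpow (r : ℝ) : IntegrableOn (fun z : ℝ => z ^ r) (Ioc (1 / 2) 1) := by
  refine (ContinuousOn.integrableOn_Icc fun z hz => ?_).mono_set Ioc_subset_Icc_self
  exact (Real.continuousAt_rpow_const _ _ (Or.inl (by linarith [hz.1]))).continuousWithinAt

theorem isProbabilityMeasure_factorMeasure {lam : ℝ} (hlam : lam < 1) :
    IsProbabilityMeasure (factorMeasure lam) := by
  constructor
  have hq : 1 - (2 : ℝ) ^ (lam - 1) ≠ 0 := by linarith [two_rpow_lt_one hlam]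
  rw [factorMeasure, withDensity_apply _ MeasurableSet.univ, Measure.restrict_univ,
    ← ofReal_integral_eq_lintegral_ofReal ((integrableOn_rpow _).const_mul _)
      (ae_restrict_of_forall_mem measurableSet_Ioc fun z hz => density_nonneg hlam hz),
    integral_const_mul, setIntegral_rpow (by linarith), psiZero,
    show -(-lam + 1) = lam - 1 by ring, show -lam + 1 = 1 - lam by ring,
    div_mul_div_cancel₀ hq, div_self (by linarith), ENNReal.ofReal_one]

/-- Computing the mean of `z ^ δ` gives `1 / 2` precisely by the exponent equation. -/
theorem isSplitting_factorMeasure {lam Δ : ℝ} (hlam : lam < 1) (hΔ : 0 < Δ)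
    (he : ExponentEquation lam Δ) :
    IsSplitting (factorMeasure lam) fun z => z ^ ((1 - lam) * Δ) := by
  have hd : 0 < (1 - lam) * Δ := mul_pos (by linarith) hΔ
  refine ⟨measurable_id.pow_const _, ?_, ?_⟩
  · filter_upwards [ae_factorMeasure lam] with z hz
    have hz0 : 0 < z := by linarith [hz.1]
    exact ⟨Real.rpow_pos_of_pos hz0 _, Real.rpow_lt_one hz0.le hz.2 hd⟩
  · have hq : 1 - (2 : ℝ) ^ (lam - 1) ≠ 0 := by linarith [two_rpow_lt_one hlam]
    have hl : 1 - lam ≠ 0 := by linarith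
    rw [integral_factorMeasure hlam]
    have : ∀ z ∈ Ioc (1 / 2 : ℝ) 1, psiZero lam * z ^ (-lam) * z ^ ((1 - lam) * Δ) =
        psiZero lam * z ^ (-lam + (1 - lam) * Δ) := fun z hz => by
      rw [mul_assoc, ← Real.rpow_add (by linarith [hz.1])]
    rw [setIntegral_congr_fun measurableSet_Ioc this, integral_const_mul,
      setIntegral_rpow (by linarith),
      show -(-lam + (1 - lam) * Δ + 1) = (lam - 1) * (Δ + 1) by ring,
      show -lam + (1 - lam) * Δ + 1 = (1 - lam) * (1 + Δ) by ring, psiZero]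
    rw [ExponentEquation, eq_div_iff hq] at he
    rw [← he]
    field_simp

/-- The substitution `y = a * z`. -/
theorem solvesAt_id_iff {lam : ℝ} (hlam : lam < 1) (h : ℝ → ℝ) {a : ℝ} (ha : 0 < a) :
    SolvesAt (factorMeasure lam) (fun z => z) h a ↔
      IntervalIntegrable (fun y => y ^ (-lam) * h y ^ 2) volume (a / 2) a ∧
      a ^ (1 - lam) * h a = psiZero lam * ∫ y in (a / 2)..a, y ^ (-lam) * h y ^ 2 := by
  have hp := psiZero_pos hlam
  have hal : 0 < a ^ (-lam) := Real.rpow_pos_of_pos ha _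
  set g : ℝ → ℝ := fun y => y ^ (-lam) * h y ^ 2 with hg
  have hE : EqOn (fun z => psiZero lam * z ^ (-lam) * h (a * z) ^ 2)
      (fun z => psiZero lam / a ^ (-lam) * g (a * z)) (Ioc (1 / 2) 1) := fun z hz => by
    simp only [hg]
    rw [Real.mul_rpow ha.le (by linarith [hz.1])]
    field_simp
  rw [SolvesAt, integrable_factorMeasure_iff hlam, integral_factorMeasure hlam,
    integrableOn_congr_fun hE measurableSet_Ioc, setIntegral_congr_fun measurableSet_Ioc hE,
    integral_const_mul, ← intervalIntegral.integral_of_le (by norm_num),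
    intervalIntegral.integral_comp_mul_left _ ha.ne', mul_one, mul_one_div,
    ← intervalIntegrable_iff_integrableOn_Ioc_of_le (by norm_num)]
  refine and_congr ?_ ?_
  · have h1 := IntervalIntegrable.comp_mul_left_iff (f := g) (a := a / 2) (b := a) ha.ne'
    rw [div_self ha.ne', div_right_comm, div_self ha.ne'] at h1
    rw [← h1]
    refine ⟨fun h2 => ?_, fun h2 => h2.const_mul _⟩
    have := h2.const_mul (a ^ (-lam) / psiZero lam)
    refine this.congr fun z _ => ?_
    field_simp
  · rw [show (1 - lam) = -lam + 1 by ring, Real.rpow_add_one ha.ne', smul_eq_mul]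
    field_simp

theorem isScalingSolution_iff {lam : ℝ} (hlam : lam < 1) (Φ : ℝ → ℝ) :
    IsScalingSolution (diagonalKernel lam) Φ ↔ ∀ a, 0 < a →
      SolvesAt (factorMeasure lam) (fun z => z)
        (fun x => x ^ (1 + lam) * Φ x / psiZero lam) a := by
  rw [isScalingSolution_diagonalKernel_iff]
  refine forall₂_congr fun a ha => ?_
  rw [solvesAt_id_iff hlam _ ha]
  have hp := psiZero_pos hlam
  have hE : EqOn (fun y => y ^ (-lam) * (y ^ (1 + lam) * Φ y / psiZero lam) ^ 2)
      (fun y => (1 / psiZero lam ^ 2) * (y ^ (lam + 2) * Φ y ^ 2)) (Ioc (a / 2) a) :=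
    fun y hy => by
      have hy0 : 0 < y := by linarith [hy.1]
      have h1 : y ^ (lam + 2) = y ^ (-lam) * (y ^ (1 + lam)) ^ 2 := by
        rw [← Real.rpow_natCast, ← Real.rpow_mul hy0.le, ← Real.rpow_add hy0]
        congr 1
        push_cast
        ring
      simp only [h1]
      field_simp
  have hle : a / 2 ≤ a := by linarith
  rw [intervalIntegrable_iff_integrableOn_Ioc_of_le hle,
    intervalIntegral.integral_of_le hle, integrableOn_congr_fun hE measurableSet_Ioc,
    setIntegral_congr_fun measurableSet_Ioc hE, integral_const_mul]
  refine and_congr ?_ ?_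
  · refine ⟨fun h => h.const_mul _, fun h => ?_⟩
    have := h.const_mul (psiZero lam ^ 2)
    refine this.congr (ae_of_all _ fun y => ?_)
    simp only
    field_simp
  · have h2 : a ^ (1 - lam) * (a ^ (1 + lam) * Φ a / psiZero lam) = a ^ 2 * Φ a / psiZero lam := by
      rw [mul_div_assoc', ← mul_assoc, ← Real.rpow_add ha, show 1 - lam + (1 + lam) = 2 by ring,
        Real.rpow_two]
    rw [h2]
    field_simp

end DiagonalAggregation

/-! ### Smoothness of solutions on the open half-line. -/

namespace DiagonalAggregation

open SmoothingEquation

section Regularity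

variable {lam : ℝ} {h : ℝ → ℝ}

/-- The equation gives integrability only on the intervals from `a / 2` to `a`; these are chained
dyadically down from `y`. -/
theorem intervalIntegrable_of_solvesAt (hlam : lam < 1)
    (hs : ∀ a, 0 < a → SolvesAt (factorMeasure lam) (fun z => z) h a) {x y : ℝ} (hx : 0 < x)
    (hy : 0 < y) : IntervalIntegrable (fun y => y ^ (-lam) * h y ^ 2) volume x y := by
  wlog hxy : x ≤ y generalizing x y
  · exact (this hy hx (le_of_not_ge hxy)).symm
  have hn : ∀ n : ℕ, IntervalIntegrable (fun y => y ^ (-lam) * h y ^ 2) volume (y / 2 ^ n) y := by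
    intro n
    induction n with
    | zero => simp
    | succ n ih =>
      have := ((solvesAt_id_iff hlam h (a := y / 2 ^ n) (by positivity)).1
        (hs _ (by positivity))).1
      rw [div_div, ← pow_succ] at this
      exact this.trans ih
  obtain ⟨n, hn'⟩ := exists_pow_lt_of_lt_one (div_pos hx hy) (one_half_lt_one (α := ℝ))
  have hle : y / 2 ^ n ≤ x := by
    rw [one_div, inv_pow, lt_div_iff₀ hy] at hn'
    rw [div_eq_mul_inv, mul_comm]
    exact hn'.le
  refine (hn n).mono_set ?_
  rw [uIcc_of_le hxy, uIcc_of_le (hle.trans hxy)]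
  exact Icc_subset_Icc_left hle

theorem eq_primitive_of_solvesAt (hlam : lam < 1)
    (hs : ∀ a, 0 < a → SolvesAt (factorMeasure lam) (fun z => z) h a) :
    EqOn h (fun x => psiZero lam * x ^ (-(1 - lam)) *
      ((∫ y in (1 : ℝ)..x, y ^ (-lam) * h y ^ 2) -
        ∫ y in (1 : ℝ)..(1 / 2 * x), y ^ (-lam) * h y ^ 2)) (Ioi 0) := by
  intro x hx
  have hx0 : 0 < x := hx
  have hi := fun {b : ℝ} (hb : 0 < b) => intervalIntegrable_of_solvesAt hlam hs one_pos hb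
  have := ((solvesAt_id_iff hlam h hx0).1 (hs x hx)).2
  simp only
  rw [intervalIntegral.integral_interval_sub_left (hi hx0) (hi (by linarith)),
    show 1 / 2 * x = x / 2 by ring, mul_right_comm, ← this, Real.rpow_neg hx0.le]
  have := Real.rpow_pos_of_pos hx0 (1 - lam)
  field_simp

theorem continuousOn_of_solvesAt (hlam : lam < 1)
    (hs : ∀ a, 0 < a → SolvesAt (factorMeasure lam) (fun z => z) h a) :
    ContinuousOn h (Ioi 0) := by
  have hI : ContinuousOn (fun x => ∫ y in (1 : ℝ)..x, y ^ (-lam) * h y ^ 2) (Ioi 0) := by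
    intro x hx
    have hx0 : 0 < x := hx
    have h1 : min (x / 2) (1 / 2) ≤ x / 2 := min_le_left _ _
    have h2 : min (x / 2) (1 / 2) ≤ 1 / 2 := min_le_right _ _
    have h3 : 2 * x ≤ max (2 * x) 2 := le_max_left _ _
    have h4 : 2 ≤ max (2 * x) 2 := le_max_right _ _
    have := intervalIntegral.continuousOn_primitive_interval' (a := 1)
      (intervalIntegrable_of_solvesAt hlam hs (x := min (x / 2) (1 / 2)) (y := max (2 * x) 2)
        (by positivity) (by positivity))
      (by rw [uIcc_of_le (by linarith)]; constructor <;> linarith)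
    rw [uIcc_of_le (by linarith)] at this
    exact (this.continuousAt (Icc_mem_nhds (by linarith) (by linarith))).continuousWithinAt
  refine ContinuousOn.congr ?_ (eq_primitive_of_solvesAt hlam hs)
  refine ContinuousOn.mul (continuousOn_const.mul fun x hx =>
    (Real.continuousAt_rpow_const _ _ (Or.inl (ne_of_gt hx))).continuousWithinAt)
    (hI.sub (hI.comp (f := fun x => 1 / 2 * x) (by fun_prop) fun x hx => ?_))
  exact mul_pos (by norm_num : (0 : ℝ) < 1 / 2) hx

/-- Bootstrap: `h` is a power times a difference of primitives of `y ^ (-lam) * h y ^ 2`, so it has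
one more derivative than is already known. -/
theorem contDiffOn_of_solvesAt (hlam : lam < 1)
    (hs : ∀ a, 0 < a → SolvesAt (factorMeasure lam) (fun z => z) h a) :
    ContDiffOn ℝ ∞ h (Ioi 0) := by
  have hpow : ∀ r : ℝ, ∀ n : WithTop ℕ∞, ContDiffOn ℝ n (fun x : ℝ => x ^ r) (Ioi 0) :=
    fun r n x hx => (Real.contDiffAt_rpow_const_of_ne (ne_of_gt hx)).contDiffWithinAt
  have hgc : ContinuousOn (fun y => y ^ (-lam) * h y ^ 2) (Ioi 0) :=
    (hpow _ 0).continuousOn.mul ((continuousOn_of_solvesAt hlam hs).pow 2)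
  have hd : ∀ x ∈ Ioi (0 : ℝ), HasDerivAt (fun x => ∫ y in (1 : ℝ)..x, y ^ (-lam) * h y ^ 2)
      (x ^ (-lam) * h x ^ 2) x := fun x hx =>
    intervalIntegral.integral_hasDerivAt_right
      (intervalIntegrable_of_solvesAt hlam hs one_pos hx)
      (hgc.stronglyMeasurableAtFilter isOpen_Ioi x hx) (hgc.continuousAt (Ioi_mem_nhds hx))
  rw [contDiffOn_infty]
  intro n
  induction n with
  | zero => exact contDiffOn_zero.2 (continuousOn_of_solvesAt hlam hs)
  | succ n ih =>
    have hI : ContDiffOn ℝ (n + 1) (fun x => ∫ y in (1 : ℝ)..x, y ^ (-lam) * h y ^ 2) (Ioi 0) := by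
      refine (contDiffOn_succ_iff_deriv_of_isOpen isOpen_Ioi).2
        ⟨fun x hx => (hd x hx).differentiableAt.differentiableWithinAt, by simp, ?_⟩
      exact ((hpow _ _).mul (ih.pow 2)).congr fun x hx => (hd x hx).deriv
    push_cast
    refine ContDiffOn.congr ?_ (eq_primitive_of_solvesAt hlam hs)
    refine ContDiffOn.mul (contDiffOn_const.mul (hpow _ _))
      (hI.sub (hI.comp (f := fun x => 1 / 2 * x) (by fun_prop) fun x hx => ?_))
    exact mul_pos (by norm_num : (0 : ℝ) < 1 / 2) hx

end Regularity

/-! ### The normalised solution: construction and uniqueness. -/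

/-- Passage to the variable `κ x ^ δ`. -/
theorem solvesAt_comp_rpow_iff {lam δ κ : ℝ} {h F : ℝ → ℝ}
    (hF : ∀ x, 0 < x → h x = F (κ * x ^ δ)) {a : ℝ} (ha : 0 < a) :
    SolvesAt (factorMeasure lam) (fun z => z) h a ↔
      SolvesAt (factorMeasure lam) (fun z => z ^ δ) F (κ * a ^ δ) := by
  have : (fun z => h (a * z) ^ 2) =ᵐ[factorMeasure lam] fun z => F (κ * a ^ δ * z ^ δ) ^ 2 := by
    filter_upwards [ae_factorMeasure lam] with z hz
    have hz0 : 0 < z := by linarith [hz.1]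
    rw [hF _ (mul_pos ha hz0), Real.mul_rpow ha.le hz0.le, mul_assoc]
  rw [SolvesAt, SolvesAt, integrable_congr this, integral_congr_ae this, hF a ha]

/-- The solution of the equation in the variable `s = x ^ δ`, normalised to `1 - s + O (s ^ 2)`. -/
structure IsNormalizedSolution (lam δ : ℝ) (F : ℝ → ℝ) : Prop where
  measurable : Measurable F
  zero : F 0 = 1
  pos : ∀ s, 0 ≤ s → 0 < F s
  le_one : ∀ s, F s ≤ 1
  solves : ∀ s, 0 < s → SolvesAt (factorMeasure lam) (fun z => z ^ δ) F s
  expansion : ∃ K : ℝ, ∀ s, 0 ≤ s → |F s - (1 - s)| ≤ K * s ^ 2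
  strictAnti : StrictAntiOn F (Ici 0)
  decay : ∃ C a : ℝ, 0 < C ∧ 0 < a ∧ ∀ x ∈ Ici (0 : ℝ), F (x ^ δ) ≤ C * Real.exp (-(a * x))
  smooth : ContDiffOn ℝ ∞ F (Ici 0)

theorem exists_isNormalizedSolution {lam Δ : ℝ} (hlam : lam < 1) (hΔ : 0 < Δ)
    (he : ExponentEquation lam Δ) : ∃ F, IsNormalizedSolution lam ((1 - lam) * Δ) F := by
  have hsp := isSplitting_factorMeasure hlam hΔ he
  have := isProbabilityMeasure_factorMeasure hlam
  set δ := (1 - lam) * Δ with hδ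
  have hδ0 : 0 < δ := mul_pos (by linarith) hΔ
  obtain ⟨F, hmeas, hmem, heq, hlow, ⟨K, hK⟩, hanti, hconv⟩ := hsp.exists_solution
  have hsol : ∀ s, 0 < s → SolvesAt (factorMeasure lam) (fun z => z ^ δ) F s := fun s hs =>
    ⟨hsp.integrable_sq hmeas hmem s, heq s hs.le⟩
  have hF0 : F 0 = 1 := by
    have := hK 0 le_rfl
    simp only [sub_zero, ne_eq, OfNat.ofNat_ne_zero, not_false_eq_true, zero_pow, mul_zero,
      abs_nonpos_iff] at this
    linarith
  have hpos : ∀ s, 0 ≤ s → 0 < F s := fun s hs => (Real.exp_pos _).trans_le (hlow s hs)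
  have hlt : ∀ s, 0 < s → F s < 1 := fun s hs => by
    -- At such a small `u` the expansion gives `F u ≤ 1 - u + K * u ^ 2 < 1`; monotonicity carries
    -- this to `s`.
    have hu : 0 < min s (1 / (2 * (|K| + 1))) := by positivity
    refine (hanti (mem_Ici.2 hu.le) hs.le (min_le_left _ _)).trans_lt ?_
    set u := min s (1 / (2 * (|K| + 1)))
    have h1 := (abs_le.1 (hK u hu.le)).2
    have h2 : (|K| + 1) * u ≤ 1 / 2 := by
      have : u ≤ 1 / (2 * (|K| + 1)) := min_le_right _ _
      calc (|K| + 1) * u ≤ (|K| + 1) * (1 / (2 * (|K| + 1))) := by gcongr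
        _ = 1 / 2 := by field_simp
    have h3 : K * u ≤ 1 / 2 := by nlinarith [le_abs_self K]
    nlinarith
  -- As `z > 1 / 2`, every argument `2 ^ δ * s * z ^ δ` in the average is at least `s`.
  have hdouble : ∀ s, 0 ≤ s → F (2 ^ δ * s) ≤ F s ^ 2 := fun s hs => by
    have h2 : 0 ≤ (2 : ℝ) ^ δ * s := mul_nonneg (Real.rpow_nonneg zero_le_two _) hs
    rw [heq _ h2]
    have := integral_mono_ae (hsp.integrable_sq hmeas hmem (2 ^ δ * s))
      (integrable_const (F s ^ 2)) (by
        filter_upwards [ae_factorMeasure lam] with z hz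
        have hz0 : 0 < z := by linarith [hz.1]
        refine pow_le_pow_left₀ (hmem _).1 (hanti hs
          (mul_nonneg h2 (Real.rpow_nonneg hz0.le _)) ?_) 2
        rw [mul_right_comm, ← Real.mul_rpow zero_le_two hz0.le]
        exact le_mul_of_one_le_left hs (Real.one_le_rpow (by linarith [hz.1]) hδ0.le))
    simpa using this
  have hrp : ∀ x : ℝ, 0 ≤ x → (0 : ℝ) ≤ x ^ δ := fun x hx => Real.rpow_nonneg hx δ
  refine ⟨F, hmeas, hF0, hpos, fun s => (hmem s).2, hsol, ⟨K, hK⟩, ?_, ?_, ?_⟩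
  · intro s hs t ht hst
    -- If `F s = F t`, convexity gives `F t ≤ F u` for `u = 2 ^ δ * t`, whereas doubling gives `F u
    -- ≤ F t ^ 2 < F t`.
    refine (hanti hs ht hst.le).lt_of_ne fun hEq => ?_
    have ht0 : 0 < t := lt_of_le_of_lt hs hst
    have hlt2 : t < 2 ^ δ * t :=
      lt_mul_of_one_lt_left ht0 (Real.one_lt_rpow one_lt_two hδ0)
    set u := (2 : ℝ) ^ δ * t
    have h1 : F t ≤ F u := by
      have := hconv.2 hs (mem_Ici.2 (ht0.trans hlt2).le)
        (show 0 ≤ (u - t) / (u - s) from div_nonneg (by linarith) (by linarith))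
        (show 0 ≤ (t - s) / (u - s) from div_nonneg (by linarith) (by linarith))
        (by rw [← add_div, sub_add_sub_cancel, div_self (by linarith)])
      have hus : 0 < u - s := by linarith
      have e1 : (u - t) / (u - s) * s + (t - s) / (u - s) * u = t := by
        field_simp
        ring
      simp only [smul_eq_mul, e1] at this
      rw [← hEq, div_mul_eq_mul_div, div_mul_eq_mul_div, ← add_div, le_div_iff₀ hus] at this
      nlinarith
    have h2 := hdouble t ht0.le
    have h3 := hlt t ht0
    have h4 := hpos t ht0.le
    nlinarith
  · refine exists_exp_bound (h := fun x => F (x ^ δ)) (fun x hx y hy hxy => ?_)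
      (fun x hx => hpos _ (hrp x hx)) (fun x _ => (hmem _).2) (fun x hx => ?_) one_pos
      (by simpa using hlt 1 one_pos)
    · exact hanti (hrp x hx) (hrp y hy) (Real.rpow_le_rpow hx hxy hδ0.le)
    · rw [Real.mul_rpow zero_le_two hx]
      exact hdouble _ (hrp x hx)
  · intro s hs
    rcases (mem_Ici.1 hs).eq_or_lt with h0 | h0
    · rw [← h0]
      exact hsp.contDiffWithinAt_zero hsol hF0 hK
    · have hh : ContDiffOn ℝ ∞ (fun x => F (x ^ δ)) (Ioi 0) :=
        contDiffOn_of_solvesAt hlam fun a ha =>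
          (solvesAt_comp_rpow_iff (κ := 1) (F := F) (fun x _ => by rw [one_mul]) ha).2
            (hsol _ (by rw [one_mul]; exact Real.rpow_pos_of_pos ha _))
      -- Smoothness is known in the variable `x`; composing with the smooth inverse of `x ↦ x ^ δ`
      -- transfers it to `F`.
      have hc : ContDiffOn ℝ ∞ (fun t : ℝ => F ((t ^ (1 / δ)) ^ δ)) (Ioi 0) :=
        hh.comp (f := fun t : ℝ => t ^ (1 / δ))
          (fun x hx => (Real.contDiffAt_rpow_const_of_ne (ne_of_gt hx)).contDiffWithinAt)
          fun x hx => Real.rpow_pos_of_pos hx _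
      have hc' : ContDiffOn ℝ ∞ F (Ioi 0) := hc.congr fun t ht => by
        rw [← Real.rpow_mul (le_of_lt ht), one_div_mul_cancel hδ0.ne', Real.rpow_one]
      exact (hc'.contDiffAt (Ioi_mem_nhds h0)).contDiffWithinAt

theorem exists_bound_of_continuousOn {G : ℝ → ℝ} {l : ℝ} (hc : ContinuousOn G (Ioi 0))
    (hl : Tendsto G (𝓝[>] 0) (𝓝 l)) (S : ℝ) : ∃ B, ∀ s ∈ Ioc 0 S, |G s| ≤ B := by
  obtain ⟨r, hr, hsub⟩ := mem_nhdsGT_iff_exists_Ioc_subset.1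
    (hl.abs.eventually_le_const (lt_add_one |l|))
  obtain ⟨B, hB⟩ := (isCompact_Icc (a := r) (b := S)).exists_bound_of_continuousOn
    (hc.mono fun x hx => lt_of_lt_of_le hr hx.1)
  refine ⟨max (|l| + 1) B, fun s hs => ?_⟩
  rcases le_total s r with h | h
  · exact (hsub ⟨hs.1, h⟩).trans (le_max_left _ _)
  · exact (hB s ⟨h, hs.2⟩).trans (le_max_right _ _)

/-- Uniqueness of the solution with a given expansion. -/
theorem IsNormalizedSolution.eqOn {lam Δ : ℝ} (hlam : lam < 1) (hΔ : 0 < Δ)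
    (he : ExponentEquation lam Δ) {F : ℝ → ℝ} (hF : IsNormalizedSolution lam ((1 - lam) * Δ) F)
    {c ε : ℝ} (hc : 0 < c) (hε : 0 < ε) {Ψ : ℝ → ℝ}
    (hΨ : IsScalingSolution (diagonalKernel lam) Ψ)
    (hexp : HasExpansion lam ((1 - lam) * Δ) c ε Ψ) {x : ℝ} (hx : 0 < x) :
    x ^ (1 + lam) * Ψ x / psiZero lam = F (c / psiZero lam * x ^ ((1 - lam) * Δ)) := by
  have hsp := isSplitting_factorMeasure hlam hΔ he
  have := isProbabilityMeasure_factorMeasure hlam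
  set δ := (1 - lam) * Δ with hδ
  have hδ0 : 0 < δ := mul_pos (by linarith) hΔ
  have hp := psiZero_pos hlam
  set κ := c / psiZero lam with hκ
  have hκ0 : 0 < κ := div_pos hc hp
  rw [isScalingSolution_iff hlam] at hΨ
  set h : ℝ → ℝ := fun x => x ^ (1 + lam) * Ψ x / psiZero lam with hh
  -- The inverse of `x ↦ κ * x ^ δ`; it carries the competing solution to the variable of `F`.
  set τ : ℝ → ℝ := fun s => (s / κ) ^ (1 / δ) with hτ
  have hτpos : ∀ s, 0 < s → 0 < τ s := fun s hs => Real.rpow_pos_of_pos (div_pos hs hκ0) _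
  have hτδ : ∀ s, 0 < s → τ s ^ δ = s / κ := fun s hs => by
    rw [hτ, ← Real.rpow_mul (div_pos hs hκ0).le, one_div_mul_cancel hδ0.ne', Real.rpow_one]
  have hτinv : ∀ y, 0 < y → τ (κ * y ^ δ) = y := fun y hy => by
    simp only [hτ]
    rw [mul_div_cancel_left₀ _ hκ0.ne', ← Real.rpow_mul hy.le, mul_one_div_cancel hδ0.ne',
      Real.rpow_one]
  have hG : ∀ y, 0 < y → h y = (h ∘ τ) (κ * y ^ δ) := fun y hy => by
    rw [Function.comp_apply, hτinv y hy]
  have hτc : Continuous τ :=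
    (continuous_id.div_const κ).rpow_const fun _ => Or.inr (by positivity)
  have hτ0 : Tendsto τ (𝓝[>] 0) (𝓝[>] 0) := by
    refine tendsto_nhdsWithin_iff.2 ⟨?_, eventually_nhdsWithin_of_forall hτpos⟩
    have := (hτc.tendsto 0).mono_left (nhdsWithin_le_nhds (s := Ioi 0))
    simpa [hτ, Real.zero_rpow (inv_ne_zero hδ0.ne')] using this
  -- The remainder `x ^ (δ + ε)` expressed as a power of `s`. The contraction needs only that this
  -- exponent exceeds `1`.
  set b := 1 + ε / δ with hb
  have hb1 : 1 < b := lt_add_of_pos_right _ (by positivity)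
  have hGO : (fun s => (h ∘ τ) s - (1 - s)) =O[𝓝[>] 0] fun s : ℝ => s ^ b := by
    have h1 := (hexp.comp_tendsto hτ0).const_mul_left (1 / psiZero lam)
    refine (h1.congr' ?_ (EventuallyEq.refl _ _)).trans (IsBigO.of_bound (κ⁻¹ ^ b) ?_)
    · filter_upwards [self_mem_nhdsWithin] with s hs
      simp only [Function.comp_apply, hh, hτδ s hs, hκ]
      field_simp
    · filter_upwards [self_mem_nhdsWithin] with s hs
      have hs0 : 0 < s := hs
      have h2 : τ s ^ (δ + ε) = κ⁻¹ ^ b * s ^ b := by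
        rw [← Real.mul_rpow (by positivity) hs0.le, inv_mul_eq_div, ← hτδ s hs,
          ← Real.rpow_mul (hτpos s hs).le, hb]
        congr 1
        field_simp
      rw [Function.comp_apply, h2, norm_mul, Real.norm_of_nonneg (by positivity)]
  obtain ⟨K, hK⟩ := hF.expansion
  have hpowO : ∀ {p q : ℝ}, q ≤ p → (fun s : ℝ => s ^ p) =O[𝓝[>] 0] fun s : ℝ => s ^ q := by
    intro p q hpq
    refine IsBigO.of_bound 1 ?_
    filter_upwards [Ioc_mem_nhdsGT one_pos] with s hs
    rw [one_mul, Real.norm_of_nonneg (Real.rpow_nonneg hs.1.le _),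
      Real.norm_of_nonneg (Real.rpow_nonneg hs.1.le _)]
    exact Real.rpow_le_rpow_of_exponent_ge hs.1 hs.2 hpq
  have hFO : (fun s => F s - (1 - s)) =O[𝓝[>] 0] fun s : ℝ => s ^ (2 : ℝ) := by
    refine IsBigO.of_bound K ?_
    filter_upwards [self_mem_nhdsWithin] with s hs
    have hs0 : 0 < s := hs
    rw [Real.rpow_two, Real.norm_of_nonneg (sq_nonneg s)]
    exact hK s hs0.le
  have hG1 : Tendsto (h ∘ τ) (𝓝[>] 0) (𝓝 1) := by
    have h1 : Tendsto (fun s : ℝ => s ^ b) (𝓝[>] 0) (𝓝 0) := by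
      have := ((Real.continuous_rpow_const (zero_le_one.trans hb1.le)).tendsto 0).mono_left
        (nhdsWithin_le_nhds (s := Ioi 0))
      rwa [Real.zero_rpow (by linarith)] at this
    have h2 : Tendsto (fun s : ℝ => 1 - s) (𝓝[>] 0) (𝓝 1) := by
      have : Continuous fun s : ℝ => 1 - s := by fun_prop
      simpa using (this.tendsto 0).mono_left (nhdsWithin_le_nhds (s := Ioi 0))
    simpa only [sub_add_cancel, zero_add] using (hGO.trans_tendsto h1).add h2
  have hGc : ContinuousOn (h ∘ τ) (Ioi 0) :=
    (continuousOn_of_solvesAt hlam hΨ).comp hτc.continuousOn hτpos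
  have key := hsp.eqOn_Ioi (F := h ∘ τ) (G := F) (a := min b 2) (lt_min hb1 one_lt_two)
    (fun s hs => by
      have := (solvesAt_comp_rpow_iff hG (hτpos s hs)).1 (hΨ _ (hτpos s hs))
      rwa [hτδ s hs, mul_div_cancel₀ _ hκ0.ne'] at this)
    hF.solves (exists_bound_of_continuousOn hGc hG1)
    (fun S => ⟨1, fun s hs => abs_le.2 ⟨by linarith [hF.pos s hs.1.le], hF.le_one s⟩⟩) hG1
    (tendsto_one_of_quadratic one_pos fun s hs => hK s hs.1.le)
    (((hGO.trans (hpowO (min_le_left _ _))).sub (hFO.trans (hpowO (min_le_right _ _)))).congr_left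
      fun s => by ring)
  have := key (mul_pos hκ0 (Real.rpow_pos_of_pos hx δ))
  rwa [← hG x hx] at this

/-! ### The family of scaling solutions and its properties. -/

/-- The solution of the scaling equation with parameter `c` built from a normalised one. -/
noncomputable def scalingSolution (lam δ : ℝ) (F : ℝ → ℝ) (c x : ℝ) : ℝ :=
  x ^ (-(1 + lam)) * (psiZero lam * F (c / psiZero lam * x ^ δ))

theorem rpow_mul_scalingSolution {lam δ : ℝ} (F : ℝ → ℝ) (c : ℝ) {x : ℝ} (hx : 0 < x) :
    x ^ (1 + lam) * scalingSolution lam δ F c x = psiZero lam * F (c / psiZero lam * x ^ δ) := by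
  rw [scalingSolution, ← mul_assoc, ← Real.rpow_add hx, add_neg_cancel, Real.rpow_zero, one_mul]

theorem profile_scalingSolution {lam δ : ℝ} (hδ : 0 < δ) {F : ℝ → ℝ} (hF : F 0 = 1) (c : ℝ)
    {x : ℝ} (hx : 0 ≤ x) : profile lam (scalingSolution lam δ F c) x =
      psiZero lam * F (c / psiZero lam * x ^ δ) := by
  rcases hx.eq_or_lt with h | h
  · simp [profile, ← h, Real.zero_rpow hδ.ne', hF]
  · rw [profile, if_neg h.ne', rpow_mul_scalingSolution F c h]

namespace IsNormalizedSolution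

variable {lam δ : ℝ} {F : ℝ → ℝ}

theorem isScalingSolution (hF : IsNormalizedSolution lam δ F) (hlam : lam < 1) {c : ℝ}
    (hc : 0 < c) : IsScalingSolution (diagonalKernel lam) (scalingSolution lam δ F c) := by
  have hp := psiZero_pos hlam
  rw [isScalingSolution_iff hlam]
  intro a ha
  refine (solvesAt_comp_rpow_iff (κ := c / psiZero lam) (F := F) (fun x hx => ?_) ha).2
    (hF.solves _ (mul_pos (div_pos hc hp) (Real.rpow_pos_of_pos ha _)))
  rw [rpow_mul_scalingSolution F c hx, mul_div_cancel_left₀ _ hp.ne']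

/-- The quadratic remainder in `s` is of order `x ^ (2 * δ)`, so `ε = δ` works for every `c`. -/
theorem hasExpansion (hF : IsNormalizedSolution lam δ F) (hlam : lam < 1) {c : ℝ} (hc : 0 < c) :
    HasExpansion lam δ c δ (scalingSolution lam δ F c) := by
  have hp := psiZero_pos hlam
  obtain ⟨K, hK⟩ := hF.expansion
  refine IsBigO.of_bound (psiZero lam * K * (c / psiZero lam) ^ 2) ?_
  filter_upwards [self_mem_nhdsWithin] with x hx
  have hx0 : 0 < x := hx
  have hxd : 0 < x ^ δ := Real.rpow_pos_of_pos hx0 _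
  have h1 := hK (c / psiZero lam * x ^ δ) (by positivity)
  have h2 : psiZero lam * F (c / psiZero lam * x ^ δ) - (psiZero lam - c * x ^ δ) =
      psiZero lam * (F (c / psiZero lam * x ^ δ) - (1 - c / psiZero lam * x ^ δ)) := by
    field_simp
  rw [rpow_mul_scalingSolution F c hx0, h2, norm_mul, Real.norm_of_nonneg hp.le,
    Real.norm_eq_abs, Real.rpow_add hx0, Real.norm_of_nonneg (by positivity)]
  calc _ ≤ psiZero lam * (K * (c / psiZero lam * x ^ δ) ^ 2) := by gcongr
    _ = _ := by ring

theorem profile_pos (hF : IsNormalizedSolution lam δ F) (hlam : lam < 1) (hδ : 0 < δ) {c : ℝ}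
    (hc : 0 < c) {x : ℝ} (hx : 0 ≤ x) : 0 < profile lam (scalingSolution lam δ F c) x := by
  have hp := psiZero_pos hlam
  rw [profile_scalingSolution hδ hF.zero c hx]
  exact mul_pos hp (hF.pos _ (mul_nonneg (div_pos hc hp).le (Real.rpow_nonneg hx _)))

theorem profile_strictAntiOn (hF : IsNormalizedSolution lam δ F) (hlam : lam < 1) (hδ : 0 < δ)
    {c : ℝ} (hc : 0 < c) : StrictAntiOn (profile lam (scalingSolution lam δ F c)) (Ici 0) := by
  have hp := psiZero_pos hlam
  have hκ := div_pos hc hp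
  intro x hx y hy hxy
  rw [profile_scalingSolution hδ hF.zero c hx, profile_scalingSolution hδ hF.zero c hy]
  refine mul_lt_mul_of_pos_left (hF.strictAnti (mul_nonneg hκ.le (Real.rpow_nonneg hx _))
    (mul_nonneg hκ.le (Real.rpow_nonneg hy _)) ?_) hp
  exact mul_lt_mul_of_pos_left (Real.rpow_lt_rpow hx hxy hδ) hκ

theorem profile_decay (hF : IsNormalizedSolution lam δ F) (hlam : lam < 1) (hδ : 0 < δ) {c : ℝ}
    (hc : 0 < c) : ∃ C a : ℝ, 0 < C ∧ 0 < a ∧ ∀ x ∈ Ici (0 : ℝ),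
      profile lam (scalingSolution lam δ F c) x ≤ C * Real.exp (-(a * x)) := by
  have hp := psiZero_pos hlam
  have hκ := div_pos hc hp
  obtain ⟨C, a, hC, ha, hle⟩ := hF.decay
  refine ⟨psiZero lam * C, a * (c / psiZero lam) ^ (1 / δ), by positivity, by positivity,
    fun x hx => ?_⟩
  have hx0 : 0 ≤ x := hx
  have h1 := hle ((c / psiZero lam) ^ (1 / δ) * x) (mem_Ici.2 (by positivity))
  rw [Real.mul_rpow (by positivity) hx0, ← Real.rpow_mul hκ.le, one_div_mul_cancel hδ.ne',
    Real.rpow_one, ← mul_assoc a] at h1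
  rw [profile_scalingSolution hδ hF.zero c hx, mul_assoc]
  exact mul_le_mul_of_nonneg_left h1 hp.le

theorem contDiffOn_profile (hF : IsNormalizedSolution lam δ F) (hlam : lam < 1) (hδ : 0 < δ)
    {c : ℝ} (hc : 0 < c) : ContDiffOn ℝ ∞
      (fun s : ℝ => profile lam (scalingSolution lam δ F c) (s ^ (1 / δ))) (Ici 0) := by
  have hκ := div_pos hc (psiZero_pos hlam)
  have h1 : ContDiffOn ℝ ∞ (fun s => psiZero lam * F (c / psiZero lam * s)) (Ici 0) :=
    contDiffOn_const.mul (hF.smooth.comp (f := fun s => c / psiZero lam * s)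
      (by fun_prop) fun s hs => mul_nonneg hκ.le hs)
  refine h1.congr fun s hs => ?_
  rw [profile_scalingSolution hδ hF.zero c (Real.rpow_nonneg hs _), ← Real.rpow_mul hs,
    one_div_mul_cancel hδ.ne', Real.rpow_one]

/-- For `c = psiZero lam * μ ^ δ` the parameter acts as the dilation `x ↦ μ * x`, and the mass
equals `psiZero lam * μ ^ (lam - 1) * J`. Since `lam ≠ 1`, some `μ` makes it `1`. -/
theorem exists_mass_one (hF : IsNormalizedSolution lam δ F) (hlam : lam < 1) :
    ∃ c : ℝ, 0 < c ∧ IntegrableOn (fun x => x * scalingSolution lam δ F c x) (Ioi 0) ∧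
      ∫ x in Ioi (0 : ℝ), x * scalingSolution lam δ F c x = 1 := by
  have hp := psiZero_pos hlam
  set k : ℝ → ℝ := fun x => x ^ (-lam) * F (x ^ δ) with hk
  have hkpos : ∀ x ∈ Ioi (0 : ℝ), 0 < k x := fun x hx =>
    mul_pos (Real.rpow_pos_of_pos hx _) (hF.pos _ (Real.rpow_nonneg (le_of_lt hx) _))
  have hki : IntegrableOn k (Ioi 0) := by
    obtain ⟨C, a, hC, ha, hle⟩ := hF.decay
    have hg := (integrableOn_rpow_mul_exp_neg_mul_rpow (s := -lam) (p := 1) (by linarith)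
      one_pos ha).const_mul C
    refine Integrable.mono' hg ((measurable_id.pow_const _).mul
      (hF.measurable.comp (measurable_id.pow_const _))).aestronglyMeasurable ?_
    filter_upwards [ae_restrict_mem measurableSet_Ioi] with x hx
    have hx0 : 0 < x := hx
    rw [Real.norm_of_nonneg (hkpos x hx).le, Real.rpow_one, mul_left_comm, neg_mul]
    exact mul_le_mul_of_nonneg_left (hle x hx0.le) (Real.rpow_nonneg hx0.le _)
  have hJ : 0 < ∫ x in Ioi (0 : ℝ), k x := by
    rw [setIntegral_pos_iff_support_of_nonneg_ae
      (ae_restrict_of_forall_mem measurableSet_Ioi fun x hx => (hkpos x hx).le) hki,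
      (inter_eq_right.2 fun x hx => (hkpos x hx).ne' : Function.support k ∩ Ioi 0 = Ioi 0)]
    simp
  set J := ∫ x in Ioi (0 : ℝ), k x with hJdef
  set μ := (psiZero lam * J) ^ (1 / (1 - lam)) with hμ
  have hl : 1 - lam ≠ 0 := by linarith
  have hμ0 : 0 < μ := Real.rpow_pos_of_pos (mul_pos hp hJ) _
  have hμ1 : μ ^ (1 - lam) = psiZero lam * J := by
    rw [hμ, ← Real.rpow_mul (mul_pos hp hJ).le, one_div_mul_cancel hl, Real.rpow_one]
  have hE : EqOn (fun x => x * scalingSolution lam δ F (psiZero lam * μ ^ δ) x)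
      (fun x => psiZero lam * μ ^ lam * k (μ * x)) (Ioi 0) := fun x hx => by
    have hx0 : 0 < x := hx
    have h1 : x * x ^ (-(1 + lam)) = x ^ (-lam) := by
      rw [show -lam = 1 + -(1 + lam) by ring, Real.rpow_add hx0, Real.rpow_one]
    have h2 : μ ^ lam * μ ^ (-lam) = 1 := by
      rw [← Real.rpow_add hμ0, add_neg_cancel, Real.rpow_zero]
    simp only [hk, scalingSolution]
    rw [mul_div_cancel_left₀ _ hp.ne', Real.mul_rpow hμ0.le hx0.le, Real.mul_rpow hμ0.le hx0.le,
      ← mul_assoc x, h1]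
    linear_combination (-(psiZero lam * x ^ (-lam) * F (μ ^ δ * x ^ δ))) * h2
  refine ⟨psiZero lam * μ ^ δ, by positivity, ?_, ?_⟩
  · rw [integrableOn_congr_fun hE measurableSet_Ioi]
    refine Integrable.const_mul ?_ _
    have := (integrableOn_Ioi_comp_mul_left_iff k 0 hμ0).2 (by simpa using hki)
    exact this
  · rw [setIntegral_congr_fun measurableSet_Ioi hE, integral_const_mul,
      integral_comp_mul_left_Ioi k 0 hμ0, mul_zero, smul_eq_mul, ← hJdef]
    have h3 : μ ^ (1 - lam) * μ ^ lam = μ := by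
      rw [← Real.rpow_add hμ0, sub_add_cancel, Real.rpow_one]
    calc psiZero lam * μ ^ lam * (μ⁻¹ * J) = (psiZero lam * J) * μ ^ lam * μ⁻¹ := by ring
      _ = 1 := by rw [← hμ1, h3, mul_inv_cancel₀ hμ0.ne']

end IsNormalizedSolution

end DiagonalAggregation

theorem theorem1 (lam : ℝ) (hlam : lam < 1) :
    ∃ Δ : ℝ, 0 < Δ ∧ DiagonalAggregation.ExponentEquation lam Δ ∧
      (∀ Δ' : ℝ, 0 < Δ' → DiagonalAggregation.ExponentEquation lam Δ' → Δ' = Δ) ∧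
      ∃ ε : ℝ, 0 < ε ∧ ∃ Φ : ℝ → ℝ → ℝ,
        (∀ c : ℝ, 0 < c →
          DiagonalAggregation.IsScalingSolution (DiagonalAggregation.diagonalKernel lam) (Φ c) ∧
          DiagonalAggregation.HasExpansion lam ((1 - lam) * Δ) c ε (Φ c) ∧
          (∀ Ψ : ℝ → ℝ,
            DiagonalAggregation.IsScalingSolution (DiagonalAggregation.diagonalKernel lam) Ψ →
            (∃ ε' : ℝ, 0 < ε' ∧
              DiagonalAggregation.HasExpansion lam ((1 - lam) * Δ) c ε' Ψ) →
            EqOn Ψ (Φ c) (Ioi 0)) ∧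
          (∀ x ∈ Ici (0 : ℝ), 0 < DiagonalAggregation.profile lam (Φ c) x) ∧
          StrictAntiOn (DiagonalAggregation.profile lam (Φ c)) (Ici 0) ∧
          (∃ C a : ℝ, 0 < C ∧ 0 < a ∧
            ∀ x ∈ Ici (0 : ℝ),
              DiagonalAggregation.profile lam (Φ c) x ≤ C * Real.exp (-(a * x))) ∧
          ContDiffOn ℝ ∞
            (fun s : ℝ => DiagonalAggregation.profile lam (Φ c) (s ^ (1 / ((1 - lam) * Δ))))
            (Ici 0)) ∧
        ∃ c : ℝ, 0 < c ∧ IntegrableOn (fun x => x * Φ c x) (Ioi 0) ∧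
          ∫ x in Ioi (0 : ℝ), x * Φ c x = 1 := by
  obtain ⟨Δ, hΔ, he, huniq⟩ := DiagonalAggregation.exists_exponent hlam
  obtain ⟨F, hF⟩ := DiagonalAggregation.exists_isNormalizedSolution hlam hΔ he
  have hδ : 0 < (1 - lam) * Δ := mul_pos (by linarith) hΔ
  refine ⟨Δ, hΔ, he, huniq, (1 - lam) * Δ, hδ,
    DiagonalAggregation.scalingSolution lam ((1 - lam) * Δ) F,
    fun c hc => ⟨hF.isScalingSolution hlam hc, hF.hasExpansion hlam hc, ?_,
      fun x hx => hF.profile_pos hlam hδ hc hx, hF.profile_strictAntiOn hlam hδ hc,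
      hF.profile_decay hlam hδ hc, hF.contDiffOn_profile hlam hδ hc⟩,
    hF.exists_mass_one hlam⟩
  rintro Ψ hΨ ⟨ε', hε', hexp⟩ x hx
  have hp := DiagonalAggregation.psiZero_pos hlam
  have h1 := hF.eqOn hlam hΔ he hc hε' hΨ hexp hx
  rw [div_eq_iff hp.ne', mul_comm (F _),
    ← DiagonalAggregation.rpow_mul_scalingSolution F c hx] at h1
  exact mul_left_cancel₀ (Real.rpow_pos_of_pos hx _).ne' h1
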